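/- For real $x$ put $S(x)=-\frac1\pi\sum_{n\ge1}\frac{\sin(2n\pi x)}{n}$ (so $S(x)=\{x\}-\frac12$ if $x\notin\mathbb Z$ and $S(x)=0$ if $x\in\mathbb Z$) and $\dot S(x)=\int_0^x S(t)\,dt$. For $n\ge1$ let $\bar\mu(n)=\sum_{d\mid n}\mu(d)\sqrt d\,\mu(n/d)$, where $\mu$ is the Möbius function. For every real $x>0$ the series $\sum_{n\ge1}\frac{\bar\mu(n)}{n^2}\dot S\left(\frac nx\right)$ converges absolutely, and for a real number $\delta'$ consider the estimate $$\sum_{n\ge1}\frac{\bar\mu(n)}{n^2}\,\dot S\left(\frac nx\right)=O\left(x^{-\delta'-1}\right)\qquad(x\to\infty),\tag{2.1}$$ where the implied constant may depend on $\delta'$. The Riemann Hypothesis holds if and only if (2.1) holds for every $\delta'<0$. Furthermore, (2.1) holds unconditionally for every $\delta'<-\frac12$, and under the Riemann Hypothesis for every $\delta'$ with $-\frac12\le\delta'<0$. -/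

import Mathlib

open scoped ArithmeticFunction.Moebius Real Topology

open Asymptotics Filter

noncomputable section

/-- `μ̄(n) = ∑_{d ∣ n} μ(d) √d μ(n/d)`. -/
def muBar (n : ℕ) : ℝ :=
  ∑ d ∈ n.divisors, (μ d : ℝ) * √(d : ℝ) * (μ (n / d) : ℝ)

/-- `S(x) = -(1/π) ∑_{n ≥ 1} sin(2nπx)/n`. The series converges for every real `x`, but in general
only conditionally, so it is summed as the limit of its partial sums in the natural order; the index
`n` below stands for the term with number `n + 1`. -/
def sawS (x : ℝ) : ℝ :=
  -(1 / π) * ∑'[SummationFilter.conditional ℕ] n : ℕ,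
    Real.sin (2 * ((n : ℝ) + 1) * π * x) / ((n : ℝ) + 1)

/-- `Ṡ(x) = ∫_0^x S(t) dt`. -/
def sawSDot (x : ℝ) : ℝ := ∫ t in (0 : ℝ)..x, sawS t

/-- The `n`-th term `μ̄(n) n⁻² Ṡ(n/x)` of the series. -/
def criterionTerm (x : ℝ) (n : ℕ+) : ℝ :=
  muBar n / (n : ℝ) ^ 2 * sawSDot ((n : ℝ) / x)

/-- The estimate `∑_{n ≥ 1} μ̄(n) n⁻² Ṡ(n/x) = O(x^{-δ-1})` as `x → ∞`. -/
def CriterionBound (δ : ℝ) : Prop :=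
  (fun x : ℝ => ∑' n : ℕ+, criterionTerm x n) =O[atTop] (fun x : ℝ => x ^ (-δ - 1))

end

/-!
The Dirichlet series of `μ̄` is `1 / (ζ(s) ζ(s - 1/2))`. Inserting the Fourier series
`Ṡ(u) = ∑ (cos 2πku - 1) / (2π²k²)`, Möbius inversion cancels the sum over `k` against one of the
two Möbius factors of `μ̄`, and only a Möbius sum remains (`tsum_criterionTerm`):

  `∑ μ̄(n) n⁻² Ṡ(n/x) = -(1/2π²) Re P(2πi/x)`,  `P(z) = ∑ μ(n) n^{-3/2} (1 - e^{-nz})`.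

So the estimate is about the size of `P` near `0` on the imaginary axis. Taking absolute values gives
`P(z) = O(|z|^θ)` for `θ < 1/2` (`norm_moebiusExpSum_le`), which is the unconditional part.

*From the estimate to the Riemann Hypothesis.* The Mellin transform of `y ↦ Re P(2πiy)` at `-w` is
`cosMellin w / ζ(3/2 - w)` for `0 < Re w < 1/2` (`mellin_moebiusCosSum`). The estimate for all
`δ' < 0` makes this Mellin transform holomorphic in the whole strip `0 < Re w < 1`. As `cosMellin`
has no zero there, `ζ` has none in `1/2 < Re s < 1`, and the functional equation does the rest
(`riemannHypothesis_of_criterionBound`).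

*From the Riemann Hypothesis to the estimate.* For `Re z > 0`, Mellin inversion writes `P(z)` as the
integral of `Γ(1 - w) z^w / (w ζ(3/2 - w))` over the line `Re w = 1/4`. Littlewood's bound
`1/ζ(σ + it) = O(|t|^η)` for `σ ≥ 1/2 + ε` (`RiemannHypothesis.norm_invZeta_le`), which comes from
the Borel–Carathéodory inequality for `log ζ` and an interpolation of its Taylor coefficients,
allows the line to be moved to `Re w = 1 - ε`. There `|z^w| ≤ |z|^{1-ε} e^{π|t|/2}`, and the
exponential is exactly compensated by the decay of `Γ` (`exists_norm_Gamma_le`); a factor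
`(1 + |t|)^{-3/2+ε}` is left over, which beats the growth of `1/ζ`. Hence `P(z) = O(|z|^{1-ε})`
uniformly in `Re z > 0`, and the bound extends to the imaginary axis by continuity.
-/

/-! ### The sawtooth series and its primitive -/

/-- The power series of `-log (1 - z)` converges, conditionally, at every point `z ≠ 1` of the unit
circle, to the value given by the principal branch: Dirichlet's test and Abel's limit theorem. -/
lemma tendsto_sum_pow_div_of_norm_eq_one {e : ℂ} (he : ‖e‖ = 1) (he1 : e ≠ 1) :
    Tendsto (fun n ↦ ∑ i ∈ Finset.range n, e ^ (i + 1) / ((i : ℂ) + 1)) atTop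
      (𝓝 (-Complex.log (1 - e))) := by
  have hne : e - 1 ≠ 0 := sub_ne_zero.2 he1
  have hbound (n : ℕ) : ‖∑ i ∈ Finset.range n, e ^ (i + 1)‖ ≤ 2 / ‖e - 1‖ := by
    have h : ∑ i ∈ Finset.range n, e ^ (i + 1) = e * ((e ^ n - 1) / (e - 1)) := by
      rw [← geom_sum_eq he1, Finset.mul_sum]
      exact Finset.sum_congr rfl fun i _ ↦ by ring
    rw [h, norm_mul, he, one_mul, norm_div]
    gcongr
    calc ‖e ^ n - 1‖ ≤ ‖e ^ n‖ + ‖(1 : ℂ)‖ := norm_sub_le _ _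
      _ = 2 := by rw [norm_pow, he]; norm_num
  have hanti : Antitone (fun n : ℕ ↦ 1 / ((n : ℝ) + 1)) := fun m n h ↦ by
    have : (m : ℝ) ≤ n := by exact_mod_cast h
    dsimp only
    gcongr
  have hcau := hanti.cauchySeq_series_mul_of_tendsto_zero_of_bounded
    tendsto_one_div_add_atTop_nhds_zero_nat hbound
  obtain ⟨l, hl⟩ := cauchySeq_tendsto_of_complete hcau
  replace hl : Tendsto (fun n ↦ ∑ i ∈ Finset.range n, e ^ (i + 1) / ((i : ℂ) + 1)) atTop (𝓝 l) := by
    refine hl.congr fun n ↦ Finset.sum_congr rfl fun i _ ↦ ?_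
    rw [Complex.real_smul]
    push_cast
    ring
  have habel := Complex.tendsto_tsum_powerSeries_nhdsWithin_lt hl
  have hlog : Tendsto (fun x : ℝ ↦ -Complex.log (1 - e * x) / x) (𝓝[<] 1)
      (𝓝 (-Complex.log (1 - e))) := by
    have hslit : 1 - e ∈ Complex.slitPlane := by
      rw [Complex.mem_slitPlane_iff]
      by_contra! h
      have h1 : 1 ≤ e.re := by simpa using h.1
      have h2 : e.im = 0 := by simpa using h.2
      have h3 : e.re ≤ 1 := he ▸ Complex.re_le_norm e
      exact he1 (Complex.ext (by simpa using le_antisymm h3 h1) (by simpa using h2))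
    have hc : ContinuousAt (fun x : ℝ ↦ -Complex.log (1 - e * x) / x) 1 := by
      refine ContinuousAt.div (ContinuousAt.neg (ContinuousAt.clog (by fun_prop) (by simpa using hslit)))
        (by fun_prop) (by simp)
    have := hc.tendsto.mono_left (nhdsWithin_le_nhds (s := Set.Iio 1))
    simpa using this
  have heq : (fun x : ℝ ↦ -Complex.log (1 - e * x) / x) =ᶠ[𝓝[<] 1]
      fun x : ℝ ↦ ∑' n : ℕ, e ^ (n + 1) / ((n : ℂ) + 1) * (x : ℂ) ^ n := by
    filter_upwards [Ioo_mem_nhdsLT (show (0 : ℝ) < 1 by norm_num)] with x hx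
    have hx0 : (x : ℂ) ≠ 0 := by exact_mod_cast hx.1.ne'
    have hn : ‖e * x‖ < 1 := by
      rw [norm_mul, he, one_mul, Complex.norm_real, Real.norm_of_nonneg hx.1.le]
      exact hx.2
    rw [← ((Complex.hasSum_taylorSeries_neg_log' hn).div_const (x : ℂ)).tsum_eq]
    refine tsum_congr fun n ↦ ?_
    field_simp
    ring
  have := tendsto_nhds_unique (habel.comp tendsto_map) (hlog.congr' heq)
  rwa [this] at hl

lemma arg_one_sub_exp_mul_I {θ : ℝ} (h0 : 0 < θ) (h1 : θ < 2 * π) :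
    (1 - Complex.exp (θ * Complex.I)).arg = θ / 2 - π / 2 := by
  have hs : 0 < 2 * Real.sin (θ / 2) := by
    have := Real.sin_pos_of_pos_of_lt_pi (x := θ / 2) (by linarith) (by linarith)
    linarith
  have key : (1 - Complex.exp (θ * Complex.I)) = ((2 * Real.sin (θ / 2) : ℝ) : ℂ) *
      (Complex.cos ((θ / 2 - π / 2 : ℝ) : ℂ) + Complex.sin ((θ / 2 - π / 2 : ℝ) : ℂ) *
        Complex.I) := by
    rw [← Complex.ofReal_cos, ← Complex.ofReal_sin, Real.cos_sub_pi_div_two, Real.sin_sub_pi_div_two,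
      Complex.exp_mul_I, ← Complex.ofReal_cos, ← Complex.ofReal_sin]
    have h2 : θ = 2 * (θ / 2) := by ring
    have hc : Real.cos θ = 1 - 2 * Real.sin (θ / 2) ^ 2 := by
      conv_lhs => rw [h2]
      rw [Real.cos_two_mul, Real.cos_sq']
      ring
    have hsn : Real.sin θ = 2 * Real.sin (θ / 2) * Real.cos (θ / 2) := by
      conv_lhs => rw [h2]
      rw [Real.sin_two_mul]
    rw [hc, hsn]
    push_cast
    ring
  rw [key]
  exact Complex.arg_mul_cos_add_sin_mul_I hs ⟨by linarith, by linarith⟩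

lemma sawS_eq_fract_sub_half {x : ℝ} (hx : Int.fract x ≠ 0) : sawS x = Int.fract x - 1 / 2 := by
  have hf0 : 0 < Int.fract x := lt_of_le_of_ne (Int.fract_nonneg x) hx.symm
  have hf1 := Int.fract_lt_one x
  set θ : ℝ := 2 * π * Int.fract x with hθ
  have hθ0 : 0 < θ := by positivity
  have hθ1 : θ < 2 * π := by rw [hθ]; nlinarith [Real.pi_pos]
  set e : ℂ := Complex.exp (θ * Complex.I) with hedef
  have he : ‖e‖ = 1 := Complex.norm_exp_ofReal_mul_I θ
  have harg := arg_one_sub_exp_mul_I hθ0 hθ1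
  have he1 : e ≠ 1 := by
    intro h
    rw [← hedef, h, sub_self, Complex.arg_zero] at harg
    -- `arg 0 = 0` would force `θ = π`, for which `exp (θ I) = -1`
    have : θ = π := by linarith
    rw [hedef, this, Complex.exp_pi_mul_I] at h
    norm_num at h
  have ht := (Complex.continuous_im.tendsto _).comp (tendsto_sum_pow_div_of_norm_eq_one he he1)
  rw [Complex.neg_im, Complex.log_im, harg] at ht
  have hsum : HasSum (fun n : ℕ ↦ Real.sin (2 * ((n : ℝ) + 1) * π * x) / ((n : ℝ) + 1))
      (-(θ / 2 - π / 2)) (SummationFilter.conditional ℕ) := by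
    rw [HasSum, SummationFilter.conditional_filter_eq_map_range, tendsto_map'_iff]
    refine ht.congr fun n ↦ ?_
    simp only [Function.comp_apply, Complex.im_sum]
    refine Finset.sum_congr rfl fun i _ ↦ ?_
    have h1 : (e ^ (i + 1) / ((i : ℂ) + 1)).im = (e ^ (i + 1)).im / ((i : ℝ) + 1) := by
      have := Complex.div_ofReal_im (e ^ (i + 1)) ((i : ℝ) + 1)
      push_cast at this
      exact this
    rw [h1, hedef, ← Complex.exp_nat_mul]
    congr 1
    have h2 : ((i + 1 : ℕ) : ℂ) * (θ * Complex.I) = (((i : ℝ) + 1) * θ : ℝ) * Complex.I := by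
      push_cast
      ring
    rw [h2, Complex.exp_ofReal_mul_I_im, hθ]
    have h3 : 2 * ((i : ℝ) + 1) * π * x =
        ((i : ℝ) + 1) * (2 * π * Int.fract x) + (((i + 1 : ℕ) : ℤ) * ⌊x⌋ : ℤ) * (2 * π) := by
      nth_rewrite 1 [← Int.floor_add_fract x]
      push_cast
      ring
    rw [h3, Real.sin_add_int_mul_two_pi]
  rw [sawS, hsum.tsum_eq, hθ]
  field_simp

lemma ae_fract_ne_zero : ∀ᵐ x : ℝ, Int.fract x ≠ 0 := by
  have : (Set.range ((↑) : ℤ → ℝ)).Countable := Set.countable_range _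
  filter_upwards [this.ae_notMem MeasureTheory.volume] with x hx h
  exact hx ⟨⌊x⌋, by have := Int.floor_add_fract x; rw [h] at this; simpa using this⟩

lemma hasDerivAt_fract {x : ℝ} (hx : Int.fract x ≠ 0) : HasDerivAt (Int.fract : ℝ → ℝ) 1 x := by
  have h : (fun y : ℝ ↦ y - ⌊x⌋) =ᶠ[𝓝 x] Int.fract := by
    have h0 : (⌊x⌋ : ℝ) < x := by
      have := lt_of_le_of_ne (Int.fract_nonneg x) hx.symm
      rw [Int.fract] at this
      linarith
    filter_upwards [Ioo_mem_nhds h0 (Int.lt_floor_add_one x)] with y hy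
    rw [Int.fract, Int.floor_eq_iff.2 ⟨hy.1.le, hy.2⟩]
  exact ((hasDerivAt_id x).sub_const _).congr_of_eventuallyEq h.symm

lemma sawSDot_eq (x : ℝ) : sawSDot x = (Int.fract x ^ 2 - Int.fract x) / 2 := by
  have hcont : Continuous (fun y : ℝ ↦ (Int.fract y ^ 2 - Int.fract y) / 2) :=
    ContinuousOn.comp_fract'' (f := fun u : ℝ ↦ (u ^ 2 - u) / 2) (by fun_prop) (by norm_num)
  have hint : IntervalIntegrable sawS MeasureTheory.volume 0 x := by
    have h : IntervalIntegrable (fun y : ℝ ↦ Int.fract y - 1 / 2) MeasureTheory.volume 0 x := by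
      refine IntervalIntegrable.mono_fun' (g := fun _ ↦ 1) (by simp)
        (by fun_prop) (.of_forall fun y ↦ ?_)
      have h0 := Int.fract_nonneg y
      have h1 := Int.fract_lt_one y
      change |Int.fract y - 1 / 2| ≤ 1
      rw [abs_le]
      constructor <;> linarith
    refine h.congr_ae (MeasureTheory.ae_restrict_of_ae ?_)
    filter_upwards [ae_fract_ne_zero] with y hy
    rw [sawS_eq_fract_sub_half hy]
  have := MeasureTheory.integral_eq_of_hasDerivAt_off_countable
    (fun y : ℝ ↦ (Int.fract y ^ 2 - Int.fract y) / 2) sawS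
    (Set.countable_range ((↑) : ℤ → ℝ)) hcont.continuousOn (a := 0) (b := x) ?_ hint
  · rw [sawSDot, this]
    simp
  · rintro y ⟨-, hy⟩
    have hy : Int.fract y ≠ 0 := fun h ↦
      hy ⟨⌊y⌋, by have := Int.floor_add_fract y; rw [h] at this; simpa using this⟩
    rw [sawS_eq_fract_sub_half hy]
    have h := hasDerivAt_fract hy
    refine (((h.pow 2).sub h).div_const 2).congr_deriv ?_
    norm_num
    ring

lemma abs_sawSDot_le (x : ℝ) : |sawSDot x| ≤ 1 := by
  have h0 := Int.fract_nonneg x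
  have h1 := (Int.fract_lt_one x).le
  rw [sawSDot_eq, abs_le]
  constructor <;> nlinarith

/-- The Fourier kernel `(cos 2πu - 1) / (2π²)` of `Ṡ`. -/
noncomputable def cosKernel (u : ℝ) : ℝ := (Real.cos (2 * π * u) - 1) / (2 * π ^ 2)

lemma abs_cosKernel_le (u : ℝ) : |cosKernel u| ≤ 1 := by
  have h0 := Real.neg_one_le_cos (2 * π * u)
  have h1 := Real.cos_le_one (2 * π * u)
  have h2 : (2 : ℝ) ≤ 2 * π ^ 2 := by nlinarith [Real.pi_gt_three]
  rw [cosKernel, abs_div, abs_of_pos (show (0 : ℝ) < 2 * π ^ 2 by positivity),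
    div_le_one (by positivity)]
  refine le_trans ?_ h2
  rw [abs_le]
  constructor <;> linarith

/-- The Fourier series of `Ṡ`. -/
lemma hasSum_sawSDot (x : ℝ) :
    HasSum (fun m : ℕ+ ↦ cosKernel (m * x) / (m : ℝ) ^ 2) (sawSDot x) := by
  have hx : Int.fract x ∈ Set.Icc (0 : ℝ) 1 := ⟨Int.fract_nonneg x, (Int.fract_lt_one x).le⟩
  have h1 := hasSum_one_div_nat_pow_mul_cos one_ne_zero hx
  have h0 := hasSum_one_div_nat_pow_mul_cos one_ne_zero (x := 0) (by simp)
  have h := (h1.sub h0).div_const (2 * π ^ 2)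
  have hB (y : ℝ) : (Polynomial.map (algebraMap ℚ ℝ) (Polynomial.bernoulli (2 * 1))).eval y =
      y ^ 2 - y + 1 / 6 := by
    simp only [Polynomial.bernoulli, Polynomial.eval_map, mul_one, Finset.sum_range_succ,
      Finset.sum_range_zero]
    simp [bernoulli_eq_bernoulli'_of_ne_one, Polynomial.eval₂_add, Polynomial.eval₂_monomial]
    ring
  rw [hB, hB] at h
  rw [sawSDot_eq]
  have hF : HasSum (fun m : ℕ ↦ cosKernel (m * x) / (m : ℝ) ^ 2)
      ((Int.fract x ^ 2 - Int.fract x) / 2) := by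
    have hval : ((-1) ^ (1 + 1) * (2 * π) ^ (2 * 1) / 2 / ↑(2 * 1).factorial *
        (Int.fract x ^ 2 - Int.fract x + 1 / 6) - (-1) ^ (1 + 1) * (2 * π) ^ (2 * 1) / 2 /
        ↑(2 * 1).factorial * (0 ^ 2 - 0 + 1 / 6)) / (2 * π ^ 2) =
        (Int.fract x ^ 2 - Int.fract x) / 2 := by
      norm_num [Nat.factorial]
      field_simp
      ring
    rw [hval] at h
    refine h.congr_fun fun m ↦ ?_
    have h3 : 2 * π * (m * x) = 2 * π * m * Int.fract x + ((m : ℤ) * ⌊x⌋ : ℤ) * (2 * π) := by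
      nth_rewrite 1 [← Int.floor_add_fract x]
      push_cast
      ring
    rw [cosKernel, h3, Real.cos_add_int_mul_two_pi]
    simp only [mul_one, mul_zero, Real.cos_zero]
    ring
  refine (Function.Injective.hasSum_iff PNat.coe_injective ?_).2 hF
  intro m hm
  have : m = 0 := by
    by_contra h
    exact hm ⟨⟨m, Nat.pos_of_ne_zero h⟩, rfl⟩
  simp [this]

/-! ### Rearranging the series as a Möbius sum -/

/-- Summation of a Dirichlet convolution against a bounded weight. -/
lemma hasSum_divisorsAntidiagonal_mul {F G H : ℕ → ℝ} {M : ℝ} (hF : Summable fun n : ℕ+ ↦ F n)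
    (hG : Summable fun n : ℕ+ ↦ G n) (hH : ∀ n, |H n| ≤ M) :
    HasSum (fun n : ℕ+ ↦ (∑ p ∈ (n : ℕ).divisorsAntidiagonal, F p.1 * G p.2) * H n)
      (∑' d : ℕ+, F d * ∑' e : ℕ+, G e * H (d * e)) := by
  have hT : Summable fun p : ℕ+ × ℕ+ ↦ F p.1 * G p.2 * H (p.1 * p.2) := by
    have h := (hF.abs.mul_of_nonneg hG.abs (fun _ ↦ abs_nonneg _)
      (fun _ ↦ abs_nonneg _)).mul_right M
    refine Summable.of_norm_bounded h fun p ↦ ?_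
    rw [Real.norm_eq_abs, abs_mul, abs_mul]
    gcongr
    exact hH _
  have hval : ∑' p : ℕ+ × ℕ+, F p.1 * G p.2 * H (p.1 * p.2) =
      ∑' d : ℕ+, F d * ∑' e : ℕ+, G e * H (d * e) := by
    rw [hT.tsum_prod]
    simp_rw [mul_assoc, tsum_mul_left]
  have hS := (sigmaAntidiagonalEquivProd.hasSum_iff).2 (hval ▸ hT.hasSum)
  refine (hS.sigma fun n ↦ hasSum_fintype _).congr_fun fun n ↦ ?_
  rw [Finset.sum_mul, ← Finset.sum_coe_sort]
  refine Finset.sum_congr rfl fun p _ ↦ ?_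
  have hp := (Nat.mem_divisorsAntidiagonal.1 p.2).1
  simp [sigmaAntidiagonalEquivProd, divisorsAntidiagonalFactors, hp]

lemma summable_pnat_rpow {a : ℝ} (ha : a < -1) : Summable fun n : ℕ+ ↦ (n : ℝ) ^ a :=
  (Real.summable_nat_rpow.2 ha).comp_injective PNat.coe_injective

lemma abs_moebius_cast_le_one (n : ℕ) : |(μ n : ℝ)| ≤ 1 := by
  exact_mod_cast ArithmeticFunction.abs_moebius_le_one (n := n)

lemma summable_moebius_div_sq : Summable fun n : ℕ+ ↦ (μ n : ℝ) / (n : ℝ) ^ 2 := by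
  refine Summable.of_norm_bounded (summable_pnat_rpow (show (-2 : ℝ) < -1 by norm_num)) fun n ↦ ?_
  rw [Real.norm_eq_abs, abs_div, abs_pow, Nat.abs_cast, Real.rpow_neg (by positivity),
    Real.rpow_two, div_eq_mul_inv]
  exact mul_le_of_le_one_left (by positivity) (abs_moebius_cast_le_one n)

/-- The coefficients `μ(n) n^{-3/2}`. -/
noncomputable def moebiusCoeff (n : ℕ) : ℝ := μ n * (n : ℝ) ^ (-(3 / 2) : ℝ)

lemma abs_moebiusCoeff_le (n : ℕ) : |moebiusCoeff n| ≤ (n : ℝ) ^ (-(3 / 2) : ℝ) := by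
  rw [moebiusCoeff, abs_mul, abs_of_nonneg (Real.rpow_nonneg n.cast_nonneg _)]
  exact mul_le_of_le_one_left (by positivity) (abs_moebius_cast_le_one n)

lemma moebius_mul_sqrt_div_sq (n : ℕ+) :
    (μ n : ℝ) * √(n : ℝ) / (n : ℝ) ^ 2 = moebiusCoeff n := by
  have hn : (0 : ℝ) < n := by exact_mod_cast n.pos
  rw [moebiusCoeff, mul_div_assoc, Real.sqrt_eq_rpow, ← Real.rpow_two, ← Real.rpow_sub hn]
  norm_num

lemma summable_moebius_mul_sqrt_div_sq :
    Summable fun n : ℕ+ ↦ (μ n : ℝ) * √(n : ℝ) / (n : ℝ) ^ 2 := by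
  refine Summable.of_norm_bounded
    (summable_pnat_rpow (show (-(3 / 2) : ℝ) < -1 by norm_num)) fun n ↦ ?_
  rw [moebius_mul_sqrt_div_sq]
  exact abs_moebiusCoeff_le n

/-- Möbius inversion of the Fourier series of `Ṡ` leaves a single cosine. -/
lemma tsum_moebius_mul_sawSDot (y : ℝ) :
    ∑' e : ℕ+, (μ e : ℝ) / (e : ℝ) ^ 2 * sawSDot (e * y) = cosKernel y := by
  have h := hasSum_divisorsAntidiagonal_mul (F := fun n ↦ (μ n : ℝ) / (n : ℝ) ^ 2)
    (G := fun n ↦ 1 / (n : ℝ) ^ 2) (H := fun n ↦ cosKernel (n * y)) (M := 1)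
    summable_moebius_div_sq ?_ fun n ↦ abs_cosKernel_le _
  · have h1 (d : ℕ+) : ∑' e : ℕ+, 1 / (e : ℝ) ^ 2 * cosKernel (((d * e : ℕ) : ℝ) * y) =
        sawSDot (d * y) := by
      rw [← (hasSum_sawSDot (d * y)).tsum_eq]
      refine tsum_congr fun e ↦ ?_
      push_cast
      rw [show ((d : ℝ) * e * y) = e * (d * y) by ring]
      ring
    simp_rw [h1] at h
    rw [← h.tsum_eq, tsum_eq_single 1]
    · simp
    · intro n hn
      have hn' : (n : ℕ) ≠ 1 := fun h ↦ hn (PNat.eq h)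
      have h2 : ∑ p ∈ (n : ℕ).divisorsAntidiagonal, (μ p.1 : ℝ) / (p.1 : ℝ) ^ 2 *
          (1 / (p.2 : ℝ) ^ 2) = 0 := by
        have h3 : ∑ p ∈ (n : ℕ).divisorsAntidiagonal, (μ p.1 : ℝ) = 0 := by
          have := congrArg (fun f : ArithmeticFunction ℤ ↦ f n)
            ArithmeticFunction.moebius_mul_coe_zeta
          rw [ArithmeticFunction.coe_mul_zeta_apply, ArithmeticFunction.one_apply_ne hn'] at this
          rw [Nat.sum_divisorsAntidiagonal (fun a _ ↦ (μ a : ℝ))]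
          exact_mod_cast this
        have h4 : ∑ p ∈ (n : ℕ).divisorsAntidiagonal, (μ p.1 : ℝ) / (p.1 : ℝ) ^ 2 *
            (1 / (p.2 : ℝ) ^ 2) =
            (∑ p ∈ (n : ℕ).divisorsAntidiagonal, (μ p.1 : ℝ)) / (n : ℝ) ^ 2 := by
          rw [Finset.sum_div]
          refine Finset.sum_congr rfl fun p hp ↦ ?_
          rw [← (Nat.mem_divisorsAntidiagonal.1 hp).1]
          push_cast
          field_simp
        rw [h4, h3, zero_div]
      rw [h2, zero_mul]
  · have := summable_pnat_rpow (show (-2 : ℝ) < -1 by norm_num)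
    refine this.congr fun n ↦ ?_
    rw [Real.rpow_neg (by positivity), Real.rpow_two, one_div]

lemma muBar_div_sq (n : ℕ+) : muBar n / (n : ℝ) ^ 2 =
    ∑ p ∈ (n : ℕ).divisorsAntidiagonal,
      (μ p.1 : ℝ) * √(p.1 : ℝ) / (p.1 : ℝ) ^ 2 * ((μ p.2 : ℝ) / (p.2 : ℝ) ^ 2) := by
  rw [muBar, ← Nat.sum_divisorsAntidiagonal (fun a b ↦ (μ a : ℝ) * √(a : ℝ) * (μ b : ℝ)),
    Finset.sum_div]
  refine Finset.sum_congr rfl fun p hp ↦ ?_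
  rw [← (Nat.mem_divisorsAntidiagonal.1 hp).1]
  push_cast
  field_simp

lemma hasSum_criterionTerm (x : ℝ) :
    HasSum (criterionTerm x) (∑' d : ℕ+, moebiusCoeff d * cosKernel (d / x)) := by
  have h := hasSum_divisorsAntidiagonal_mul (F := fun n ↦ (μ n : ℝ) * √(n : ℝ) / (n : ℝ) ^ 2)
    (G := fun n ↦ (μ n : ℝ) / (n : ℝ) ^ 2) (H := fun n ↦ sawSDot (n / x)) (M := 1)
    summable_moebius_mul_sqrt_div_sq summable_moebius_div_sq fun n ↦ abs_sawSDot_le _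
  have h1 (d : ℕ+) : ∑' e : ℕ+, (μ e : ℝ) / (e : ℝ) ^ 2 * sawSDot (((d * e : ℕ) : ℝ) / x) =
      cosKernel (d / x) := by
    rw [← tsum_moebius_mul_sawSDot (d / x)]
    refine tsum_congr fun e ↦ ?_
    push_cast
    rw [show ((d : ℝ) * e / x) = e * (d / x) by ring]
  simp_rw [h1, moebius_mul_sqrt_div_sq] at h
  refine h.congr_fun fun n ↦ ?_
  rw [criterionTerm, muBar_div_sq]

/-! ### The Möbius exponential sum -/

/-- `P(z) = ∑ μ(n) n^{-3/2} (1 - e^{-nz})`, absolutely convergent for `0 ≤ Re z`. -/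
noncomputable def moebiusExpSum (z : ℂ) : ℂ :=
  ∑' n : ℕ, (moebiusCoeff n : ℂ) * (1 - Complex.exp (-(n * z)))

lemma norm_one_sub_exp_neg_le_rpow {w : ℂ} (hw : 0 ≤ w.re) {θ : ℝ} (h0 : 0 ≤ θ) (h1 : θ ≤ 1) :
    ‖1 - Complex.exp (-w)‖ ≤ 2 * ‖w‖ ^ θ := by
  rcases le_total ‖w‖ 1 with h | h
  · have h2 : ‖Complex.exp (-w) - 1‖ ≤ 2 * ‖-w‖ := Complex.norm_exp_sub_one_le (by simpa using h)
    rw [norm_neg, norm_sub_rev] at h2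
    refine h2.trans ?_
    gcongr
    simpa using Real.rpow_le_rpow_of_exponent_ge_of_imp (norm_nonneg w) h h1
      (fun _ ↦ by simp)
  · have h2 : ‖Complex.exp (-w)‖ ≤ 1 := by
      rw [Complex.norm_exp]
      simpa using hw
    calc ‖1 - Complex.exp (-w)‖ ≤ ‖(1 : ℂ)‖ + ‖Complex.exp (-w)‖ := norm_sub_le _ _
      _ ≤ 2 * 1 := by rw [norm_one]; linarith
      _ ≤ 2 * ‖w‖ ^ θ := by gcongr; exact Real.one_le_rpow h h0

lemma norm_one_sub_exp_neg_le_two {w : ℂ} (hw : 0 ≤ w.re) : ‖1 - Complex.exp (-w)‖ ≤ 2 := by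
  simpa using norm_one_sub_exp_neg_le_rpow hw le_rfl zero_le_one

lemma norm_moebiusCoeff_mul_le {z : ℂ} (hz : 0 ≤ z.re) {θ : ℝ} (h0 : 0 ≤ θ) (h1 : θ ≤ 1) (n : ℕ) :
    ‖(moebiusCoeff n : ℂ) * (1 - Complex.exp (-(n * z)))‖ ≤
      2 * ‖z‖ ^ θ * (n : ℝ) ^ (θ - 3 / 2) := by
  rcases Nat.eq_zero_or_pos n with rfl | hn
  · simp only [Nat.cast_zero, zero_mul, neg_zero, Complex.exp_zero, sub_self, mul_zero, norm_zero]
    positivity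
  have hn' : (0 : ℝ) < n := by exact_mod_cast hn
  have h2 : ‖1 - Complex.exp (-(n * z))‖ ≤ 2 * ‖(n : ℂ) * z‖ ^ θ :=
    norm_one_sub_exp_neg_le_rpow (by simpa using by positivity) h0 h1
  rw [norm_mul, Complex.norm_natCast, Real.mul_rpow hn'.le (norm_nonneg z)] at h2
  rw [norm_mul, Complex.norm_real, Real.norm_eq_abs, sub_eq_add_neg θ, Real.rpow_add hn']
  calc _ ≤ (n : ℝ) ^ (-(3 / 2) : ℝ) * (2 * ((n : ℝ) ^ θ * ‖z‖ ^ θ)) := by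
        gcongr
        exact abs_moebiusCoeff_le n
    _ = _ := by ring

lemma summable_moebiusCoeff_mul {z : ℂ} (hz : 0 ≤ z.re) :
    Summable fun n : ℕ ↦ (moebiusCoeff n : ℂ) * (1 - Complex.exp (-(n * z))) := by
  refine Summable.of_norm_bounded ((Real.summable_nat_rpow.2 ?_).mul_left (2 * ‖z‖ ^ (0 : ℝ)))
    fun n ↦ norm_moebiusCoeff_mul_le hz le_rfl zero_le_one n
  norm_num

/-- The unconditional bound, by taking absolute values in the series. -/
lemma norm_moebiusExpSum_le {θ : ℝ} (h0 : 0 ≤ θ) (h1 : θ < 1 / 2) :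
    ∃ C, ∀ z : ℂ, 0 ≤ z.re → ‖moebiusExpSum z‖ ≤ C * ‖z‖ ^ θ := by
  have hs : Summable fun n : ℕ ↦ (n : ℝ) ^ (θ - 3 / 2) :=
    Real.summable_nat_rpow.2 (by linarith)
  refine ⟨2 * ∑' n : ℕ, (n : ℝ) ^ (θ - 3 / 2), fun z hz ↦ ?_⟩
  have := tsum_of_norm_bounded (hs.hasSum.mul_left (2 * ‖z‖ ^ θ))
    (norm_moebiusCoeff_mul_le hz h0 (by linarith))
  calc ‖moebiusExpSum z‖ ≤ _ := this
    _ = _ := by ring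

lemma moebiusExpSum_mul_I_re (y : ℝ) : (moebiusExpSum (2 * π * y * Complex.I)).re =
    ∑' n : ℕ, moebiusCoeff n * (1 - Real.cos (2 * π * (n * y))) := by
  rw [moebiusExpSum, Complex.re_tsum (summable_moebiusCoeff_mul (by simp))]
  refine tsum_congr fun n ↦ ?_
  rw [Complex.re_ofReal_mul, Complex.sub_re, Complex.one_re]
  have : -((n : ℂ) * (2 * π * y * Complex.I)) = ((-(2 * π * (n * y)) : ℝ) : ℂ) * Complex.I := by
    push_cast
    ring
  rw [this, Complex.exp_ofReal_mul_I_re, Real.cos_neg]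

lemma tsum_criterionTerm (x : ℝ) : ∑' n : ℕ+, criterionTerm x n =
    -(1 / (2 * π ^ 2)) * (moebiusExpSum (2 * π * (x⁻¹ : ℝ) * Complex.I)).re := by
  rw [(hasSum_criterionTerm x).tsum_eq, moebiusExpSum_mul_I_re, ← tsum_mul_left,
    ← PNat.coe_injective.tsum_eq]
  · refine tsum_congr fun n ↦ ?_
    rw [cosKernel, div_eq_mul_inv (n : ℝ) x]
    ring
  · intro n hn
    rcases Nat.eq_zero_or_pos n with rfl | h
    · simp at hn
    · exact ⟨⟨n, h⟩, rfl⟩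

/-- The estimate with exponent `δ` follows from `P(z) = O(|z|^θ)` on the imaginary axis as soon as
`δ + 1 ≤ θ`. -/
lemma criterionBound_of_moebiusExpSum {θ δ C : ℝ} (hδ : δ + 1 ≤ θ)
    (h : ∀ z : ℂ, z.re = 0 → 0 < z.im → ‖moebiusExpSum z‖ ≤ C * ‖z‖ ^ θ) : CriterionBound δ := by
  refine IsBigO.of_bound (1 / (2 * π ^ 2) * (C * (2 * π) ^ θ)) ?_
  filter_upwards [eventually_ge_atTop 1] with x hx
  have hx0 : 0 < x := by linarith
  have hz := h (2 * π * (x⁻¹ : ℝ) * Complex.I) (by simp) (by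
    simpa using by positivity)
  have hn : ‖(2 * π * (x⁻¹ : ℝ) * Complex.I : ℂ)‖ = 2 * π * x⁻¹ := by
    simp [abs_of_pos Real.pi_pos, abs_of_pos hx0]
  have hC : 0 ≤ C * (2 * π) ^ θ := by
    have h1 := (norm_nonneg _).trans (h (2 * π * Complex.I) (by simp) (by
      simpa using Real.pi_pos))
    have hn : ‖(2 * π * Complex.I : ℂ)‖ = 2 * π := by simp [abs_of_pos Real.pi_pos]
    rwa [hn] at h1
  rw [hn, Real.mul_rpow (by positivity) (by positivity), ← mul_assoc] at hz
  rw [tsum_criterionTerm, norm_mul, norm_neg, Real.norm_of_nonneg (by positivity : 0 ≤ 1 / (2 * π ^ 2)),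
    Real.norm_of_nonneg (by positivity : 0 ≤ x ^ (-δ - 1)), mul_assoc (1 / (2 * π ^ 2))]
  refine mul_le_mul_of_nonneg_left ?_ (by positivity)
  calc _ ≤ _ := Complex.abs_re_le_norm _
    _ ≤ C * (2 * π) ^ θ * x⁻¹ ^ θ := hz
    _ ≤ C * (2 * π) ^ θ * x ^ (-δ - 1) := by
      gcongr
      rw [Real.inv_rpow hx0.le, ← Real.rpow_neg hx0.le]
      exact Real.rpow_le_rpow_of_exponent_le hx (by linarith)

theorem criterionBound_of_lt_neg_half {δ : ℝ} (hδ : δ < -(1 / 2)) : CriterionBound δ := by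
  obtain ⟨C, hC⟩ := norm_moebiusExpSum_le (le_max_left 0 (δ + 1)) (max_lt (by norm_num)
    (by linarith))
  exact criterionBound_of_moebiusExpSum (le_max_right 0 (δ + 1)) fun z hz _ ↦ hC z hz.ge

/-! ### The Mellin transform of `1 - e^{-zu}` -/

open MeasureTheory Set in
/-- The common majorant for the integrals `∫ u^{-w-1} (1 - e^{-zu}) du` with `‖z‖ ≤ B`. -/
lemma integrableOn_rpow_mul_min {B σ : ℝ} (hB : 0 < B) (h0 : 0 < σ) (h1 : σ < 1) :
    IntegrableOn (fun u : ℝ ↦ u ^ (-σ - 1) * (2 * min 1 (B * u))) (Ioi 0) := by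
  refine mellin_convergent_of_isBigO_scalar (a := 0) (b := -1) ?_ ?_ (by linarith) ?_ (by linarith)
  · exact (by fun_prop : Continuous fun u : ℝ ↦ 2 * min 1 (B * u)).locallyIntegrable.locallyIntegrableOn _
  · refine IsBigO.of_bound 2 ?_
    filter_upwards [eventually_ge_atTop 0] with u hu
    have : 0 ≤ min 1 (B * u) := le_min zero_le_one (by positivity)
    rw [neg_zero, Real.rpow_zero, norm_one, Real.norm_of_nonneg (by linarith)]
    have := min_le_left 1 (B * u)
    linarith
  · refine IsBigO.of_bound (2 * B) ?_
    filter_upwards [self_mem_nhdsWithin] with u hu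
    have hu : 0 < u := hu
    have : 0 ≤ min 1 (B * u) := le_min zero_le_one (by positivity)
    rw [neg_neg, Real.rpow_one, Real.norm_of_nonneg (by linarith), Real.norm_of_nonneg hu.le]
    have := min_le_right 1 (B * u)
    linarith

lemma norm_one_sub_exp_neg_mul_le {z : ℂ} (hz : 0 ≤ z.re) {B u : ℝ} (hB : ‖z‖ ≤ B) (hu : 0 < u) :
    ‖1 - Complex.exp (-(u * z))‖ ≤ 2 * min 1 (B * u) := by
  have hre : 0 ≤ ((u : ℂ) * z).re := by simpa using mul_nonneg hu.le hz
  rw [mul_min_of_nonneg _ _ zero_le_two]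
  refine le_min (by simpa using norm_one_sub_exp_neg_le_two hre) ?_
  have := norm_one_sub_exp_neg_le_rpow hre zero_le_one le_rfl
  rw [Real.rpow_one, norm_mul, Complex.norm_real, Real.norm_of_nonneg hu.le, mul_comm u] at this
  exact this.trans (by gcongr)

lemma norm_cpow_mul_one_sub_exp_le {z w : ℂ} (hz : 0 ≤ z.re) {B u : ℝ} (hB : ‖z‖ ≤ B)
    (hu : 0 < u) : ‖(u : ℂ) ^ (-w - 1) * (1 - Complex.exp (-(u * z)))‖ ≤
      u ^ (-w.re - 1) * (2 * min 1 (B * u)) := by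
  rw [norm_mul, Complex.norm_cpow_eq_rpow_re_of_pos hu, Complex.sub_re, Complex.neg_re,
    Complex.one_re]
  gcongr
  exact norm_one_sub_exp_neg_mul_le hz hB hu

lemma continuousOn_cpow_mul_one_sub_exp (z w : ℂ) : ContinuousOn
    (fun u : ℝ ↦ (u : ℂ) ^ (-w - 1) * (1 - Complex.exp (-(u * z)))) (Set.Ioi 0) := by
  refine ContinuousOn.mul (fun u hu ↦ ?_) (by fun_prop)
  exact (Complex.continuousAt_ofReal_cpow_const u _ (Or.inr (ne_of_gt hu))).continuousWithinAt

open MeasureTheory Set in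
lemma integrableOn_cpow_mul_one_sub_exp {z w : ℂ} (hz : 0 ≤ z.re) (h0 : 0 < w.re) (h1 : w.re < 1) :
    IntegrableOn (fun u : ℝ ↦ (u : ℂ) ^ (-w - 1) * (1 - Complex.exp (-(u * z)))) (Ioi 0) := by
  refine Integrable.mono' (integrableOn_rpow_mul_min (B := ‖z‖ + 1) (by positivity) h0 h1)
    ((continuousOn_cpow_mul_one_sub_exp z w).aestronglyMeasurable measurableSet_Ioi) ?_
  filter_upwards [ae_restrict_mem measurableSet_Ioi] with u hu
  exact norm_cpow_mul_one_sub_exp_le hz (by linarith) hu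

/-- `1 - e^{-zu}` as a function of `u`. -/
noncomputable def oneSubExp (z : ℂ) (u : ℝ) : ℂ := 1 - Complex.exp (-(u * z))

lemma mellinConvergent_oneSubExp {z w : ℂ} (hz : 0 ≤ z.re) (h0 : 0 < w.re) (h1 : w.re < 1) :
    MellinConvergent (oneSubExp z) (-w) :=
  integrableOn_cpow_mul_one_sub_exp hz h0 h1

open MeasureTheory Set in
lemma mellin_oneSubExp_one {w : ℂ} (h0 : 0 < w.re) (h1 : w.re < 1) :
    mellin (oneSubExp 1) (-w) = Complex.Gamma (1 - w) / w := by
  have hw : w ≠ 0 := fun h ↦ by simp [h] at h0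
  have hGre : 0 < (1 - w).re := by simpa using h1
  have hnorm {u : ℝ} (hu : 0 < u) : ‖(oneSubExp 1 * fun u : ℝ ↦ (u : ℂ) ^ (-w) / -w) u‖ ≤
      u ^ (-w.re) * (2 * min 1 (1 * u)) / ‖w‖ := by
    rw [Pi.mul_apply, norm_mul, norm_div, norm_neg, Complex.norm_cpow_eq_rpow_re_of_pos hu,
      Complex.neg_re, mul_div_assoc', mul_comm]
    gcongr
    exact norm_one_sub_exp_neg_mul_le (by simp) (by simp) hu
  have hparts := integral_Ioi_mul_deriv_eq_deriv_mul (a := 0) (a' := 0) (b' := 0)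
    (u := oneSubExp 1) (u' := fun u : ℝ ↦ Complex.exp (-u))
    (v := fun u : ℝ ↦ (u : ℂ) ^ (-w) / (-w)) (v' := fun u : ℝ ↦ (u : ℂ) ^ (-w - 1)) ?_ ?_ ?_ ?_ ?_ ?_
  · rw [mellin]
    simp_rw [smul_eq_mul, mul_comm _ (oneSubExp 1 _)]
    rw [hparts, sub_zero, zero_sub, Complex.Gamma_eq_integral hGre, Complex.GammaIntegral,
      ← integral_neg, ← integral_div]
    refine setIntegral_congr_fun measurableSet_Ioi fun u _ ↦ ?_
    simp only [sub_sub_cancel_left, Complex.ofReal_exp, Complex.ofReal_neg]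
    field_simp
  · intro x _
    have h : HasDerivAt (fun u : ℝ ↦ -((u : ℂ) * 1)) (-(1 * 1)) x :=
      ((Complex.ofRealCLM.hasDerivAt (x := x)).mul_const 1).neg
    exact ((h.cexp).const_sub 1).congr_deriv (by simp)
  · intro x hx
    refine ((hasDerivAt_ofReal_cpow_const (ne_of_gt hx) (neg_ne_zero.2 hw)).div_const
      (-w)).congr_deriv ?_
    field_simp
  · exact (integrableOn_cpow_mul_one_sub_exp (z := 1) (by simp) h0 h1).congr_fun
      (fun u _ ↦ mul_comm _ _) measurableSet_Ioi
  · have h : IntegrableOn (fun u : ℝ ↦ ((-u).exp : ℂ) * (u : ℂ) ^ (1 - w - 1) / (-w)) (Ioi 0) :=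
      (Complex.GammaIntegral_convergent hGre).div_const (-w)
    refine h.congr_fun (fun u _ ↦ ?_) measurableSet_Ioi
    simp [mul_div_assoc]
  · refine squeeze_zero_norm' (a := fun u ↦ 2 / ‖w‖ * u ^ (1 - w.re)) ?_ ?_
    · filter_upwards [self_mem_nhdsWithin] with u hu
      have hu : 0 < u := hu
      refine (hnorm hu).trans ?_
      rw [sub_eq_neg_add, Real.rpow_add hu, Real.rpow_one, one_mul]
      have := min_le_right 1 u
      calc _ ≤ u ^ (-w.re) * (2 * u) / ‖w‖ := by gcongr
        _ = _ := by ring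
    · have : ContinuousAt (fun u : ℝ ↦ 2 / ‖w‖ * u ^ (1 - w.re)) 0 :=
        continuousAt_const.mul (Real.continuousAt_rpow_const _ _ (Or.inr (by linarith)))
      have h := this.tendsto.mono_left (nhdsWithin_le_nhds (s := Ioi 0))
      rwa [Real.zero_rpow (by linarith), mul_zero] at h
  · refine squeeze_zero_norm' (a := fun u ↦ 2 / ‖w‖ * u ^ (-w.re)) ?_ ?_
    · filter_upwards [eventually_gt_atTop 0] with u hu
      refine (hnorm hu).trans ?_
      have := min_le_left 1 (1 * u)
      calc _ ≤ u ^ (-w.re) * (2 * 1) / ‖w‖ := by gcongr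
        _ = _ := by ring
    · simpa using (tendsto_rpow_neg_atTop h0).const_mul (2 / ‖w‖)

open MeasureTheory Set in
lemma differentiableOn_mellin_oneSubExp {w : ℂ} (h0 : 0 < w.re) (h1 : w.re < 1) :
    DifferentiableOn ℂ (fun z ↦ mellin (oneSubExp z) (-w)) {z | 0 < z.re} := by
  intro z₀ hz₀
  have hz₀ : 0 < z₀.re := hz₀
  have hs : {z : ℂ | z₀.re / 2 < z.re} ∈ 𝓝 z₀ :=
    (isOpen_lt continuous_const Complex.continuous_re).mem_nhds (by simp [hz₀])
  refine DifferentiableAt.differentiableWithinAt (HasDerivAt.differentiableAt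
    (hasDerivAt_integral_of_dominated_loc_of_deriv_le hs
    (F := fun (z : ℂ) (u : ℝ) ↦ (u : ℂ) ^ (-w - 1) • oneSubExp z u)
    (F' := fun z u ↦ (u : ℂ) ^ (-w - 1) * (u * Complex.exp (-(u * z))))
    (bound := fun u ↦ u ^ (-w.re) * Real.exp (-(z₀.re / 2) * u ^ (1 : ℝ)))
    (.of_forall fun z ↦ (continuousOn_cpow_mul_one_sub_exp z w).aestronglyMeasurable
      measurableSet_Ioi)
    (show Integrable (fun u : ℝ ↦ (u : ℂ) ^ (-w - 1) • oneSubExp z₀ u) (volume.restrict (Ioi 0))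
      from mellinConvergent_oneSubExp hz₀.le h0 h1) ?_ ?_ ?_ ?_).2)
  · refine ContinuousOn.aestronglyMeasurable (ContinuousOn.mul (fun u hu ↦ ?_) (by fun_prop))
      measurableSet_Ioi
    exact (Complex.continuousAt_ofReal_cpow_const u _ (Or.inr (ne_of_gt hu))).continuousWithinAt
  · filter_upwards [ae_restrict_mem measurableSet_Ioi] with u hu z hz
    have hu : 0 < u := hu
    have hz : z₀.re / 2 < z.re := hz
    rw [norm_mul, norm_mul, Complex.norm_cpow_eq_rpow_re_of_pos hu, Complex.norm_exp,
      Complex.norm_real, Real.norm_of_nonneg hu.le, ← mul_assoc, Complex.sub_re, Complex.neg_re,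
      Complex.one_re, Real.rpow_sub_one hu.ne', div_mul_cancel₀ _ hu.ne', Real.rpow_one]
    gcongr
    simp only [Complex.neg_re, Complex.re_ofReal_mul]
    nlinarith
  · exact integrableOn_rpow_mul_exp_neg_mul_rpow (by linarith) zero_lt_one (by linarith)
  · refine .of_forall fun u z _ ↦ ?_
    have h : HasDerivAt (fun z : ℂ ↦ -((u : ℂ) * z)) (-(u * 1)) z :=
      ((hasDerivAt_id z).const_mul (u : ℂ)).neg
    have h2 := ((h.cexp).const_sub 1).const_mul ((u : ℂ) ^ (-w - 1))
    simp only [smul_eq_mul, oneSubExp]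
    refine h2.congr_deriv ?_
    ring

lemma mellin_oneSubExp_of_re_pos {z w : ℂ} (hz : 0 < z.re) (h0 : 0 < w.re) (h1 : w.re < 1) :
    mellin (oneSubExp z) (-w) = Complex.Gamma (1 - w) / w * z ^ w := by
  have hopen : IsOpen {z : ℂ | 0 < z.re} := isOpen_lt continuous_const Complex.continuous_re
  have hconn : IsPreconnected {z : ℂ | 0 < z.re} := (convex_halfSpace_re_gt 0).isPreconnected
  have hL : AnalyticOnNhd ℂ (fun z ↦ mellin (oneSubExp z) (-w)) {z | 0 < z.re} :=
    (differentiableOn_mellin_oneSubExp h0 h1).analyticOnNhd hopen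
  have hR : AnalyticOnNhd ℂ (fun z ↦ Complex.Gamma (1 - w) / w * z ^ w) {z | 0 < z.re} := by
    refine DifferentiableOn.analyticOnNhd (fun z hz ↦ ?_) hopen
    exact ((differentiableAt_id.cpow_const (Or.inl hz)).const_mul _).differentiableWithinAt
  refine hL.eqOn_of_preconnected_of_frequently_eq hR hconn (z₀ := 1) (by simp) ?_ hz
  -- on the positive real axis the formula is the scaling law of the Mellin transform
  have hreal (x : ℝ) (hx : 0 < x) :
      mellin (oneSubExp x) (-w) = Complex.Gamma (1 - w) / w * (x : ℂ) ^ w := by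
    have : oneSubExp x = fun t ↦ oneSubExp 1 (x * t) := by
      funext t
      simp only [oneSubExp, Complex.ofReal_mul, mul_one]
      rw [mul_comm (x : ℂ)]
    rw [this, mellin_comp_mul_left _ _ hx, mellin_oneSubExp_one h0 h1, neg_neg, smul_eq_mul,
      mul_comm]
  have htend : Tendsto (fun n : ℕ ↦ ((1 + 1 / ((n : ℝ) + 1) : ℝ) : ℂ)) atTop (𝓝[≠] 1) := by
    refine tendsto_nhdsWithin_iff.2 ⟨?_, .of_forall fun n ↦ ?_⟩
    · have := (tendsto_one_div_add_atTop_nhds_zero_nat (𝕜 := ℝ)).const_add 1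
      simpa [Function.comp_def] using (Complex.continuous_ofReal.tendsto _).comp this
    · have h : (1 + 1 / ((n : ℝ) + 1)) ≠ 1 := by
        have : 0 < 1 / ((n : ℝ) + 1) := by positivity
        linarith
      exact fun h' ↦ h (Complex.ofReal_injective (by simpa using h'))
  exact htend.frequently (.of_forall fun n ↦ hreal _ (by positivity))

open MeasureTheory Set in
/-- The formula extends to the imaginary axis by dominated convergence. -/
lemma mellin_oneSubExp {z w : ℂ} (hz : 0 ≤ z.re) (hz0 : z ≠ 0) (h0 : 0 < w.re) (h1 : w.re < 1) :
    mellin (oneSubExp z) (-w) = Complex.Gamma (1 - w) / w * z ^ w := by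
  have hslit : z ∈ Complex.slitPlane := by
    rw [Complex.mem_slitPlane_iff]
    by_contra! h
    exact hz0 (Complex.ext (le_antisymm h.1 hz) h.2)
  have hε : Tendsto (fun ε : ℝ ↦ z + ε) (𝓝[>] 0) (𝓝 z) := by
    have : ContinuousAt (fun ε : ℝ ↦ z + ε) 0 := by fun_prop
    simpa using this.tendsto.mono_left (nhdsWithin_le_nhds (s := Ioi 0))
  have hright : Tendsto (fun ε : ℝ ↦ Complex.Gamma (1 - w) / w * (z + ε) ^ w) (𝓝[>] 0)
      (𝓝 (Complex.Gamma (1 - w) / w * z ^ w)) :=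
    ((continuousAt_cpow_const hslit).tendsto.comp hε).const_mul _
  have hleft : Tendsto (fun ε : ℝ ↦ mellin (oneSubExp (z + ε)) (-w)) (𝓝[>] 0)
      (𝓝 (mellin (oneSubExp z) (-w))) := by
    refine tendsto_integral_filter_of_dominated_convergence
      (fun u ↦ u ^ (-w.re - 1) * (2 * min 1 ((‖z‖ + 1) * u))) ?_ ?_
      (integrableOn_rpow_mul_min (by positivity) h0 h1) ?_
    · exact .of_forall fun ε ↦ (continuousOn_cpow_mul_one_sub_exp (z + ε) w).aestronglyMeasurable
        measurableSet_Ioi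
    · filter_upwards [Ioo_mem_nhdsGT (zero_lt_one (α := ℝ))] with ε hε
      filter_upwards [ae_restrict_mem measurableSet_Ioi] with u hu
      refine norm_cpow_mul_one_sub_exp_le ?_ ?_ hu
      · simpa using add_nonneg hz hε.1.le
      · refine (norm_add_le _ _).trans ?_
        rw [Complex.norm_real, Real.norm_of_nonneg hε.1.le]
        linarith [hε.2]
    · refine .of_forall fun u ↦ Tendsto.const_smul ?_ _
      have : Continuous fun z ↦ oneSubExp z u := by unfold oneSubExp; fun_prop
      exact (this.tendsto z).comp hε
  refine tendsto_nhds_unique hleft (hright.congr' ?_)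
  filter_upwards [self_mem_nhdsWithin] with ε hε
  refine (mellin_oneSubExp_of_re_pos ?_ h0 h1).symm
  simpa using add_pos_of_nonneg_of_pos hz hε

lemma two_pi_mul_I_cpow_add (w : ℂ) : (2 * π * Complex.I) ^ w + (-(2 * π * Complex.I)) ^ w =
    (2 * π : ℂ) ^ w * (2 * Complex.cos (π * w / 2)) := by
  have h2π : (0 : ℝ) < 2 * π := by positivity
  have hne : ((2 * π : ℝ) : ℂ) ≠ 0 := by exact_mod_cast h2π.ne'
  have h1 : (2 * π * Complex.I : ℂ) = ((2 * π : ℝ) : ℂ) * Complex.I := by push_cast; ring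
  have h2 : (-(2 * π * Complex.I) : ℂ) = ((2 * π : ℝ) : ℂ) * -Complex.I := by push_cast; ring
  have h3 : (2 * π : ℂ) = ((2 * π : ℝ) : ℂ) := by push_cast; ring
  rw [h2, h1, h3, Complex.cpow_def_of_ne_zero (by simp [Real.pi_ne_zero]),
    Complex.cpow_def_of_ne_zero (by simp [Real.pi_ne_zero]), Complex.cpow_def_of_ne_zero hne,
    Complex.log_ofReal_mul h2π (by simp), Complex.log_ofReal_mul h2π (by simp), Complex.log_I,
    Complex.log_neg_I, ← Complex.ofReal_log h2π.le, add_mul, add_mul, Complex.exp_add,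
    Complex.exp_add, Complex.cos]
  rw [show (π / 2 * Complex.I * w : ℂ) = π * w / 2 * Complex.I by ring,
    show (-(π / 2) * Complex.I * w : ℂ) = -(π * w / 2) * Complex.I by ring]
  ring

/-- The Mellin transform of `1 - cos 2πu` at `-w`. -/
noncomputable def cosMellin (w : ℂ) : ℂ :=
  Complex.Gamma (1 - w) / w * ((2 * π : ℂ) ^ w * Complex.cos (π * w / 2))

lemma cosMellin_ne_zero {w : ℂ} (h0 : 0 < w.re) (h1 : w.re < 1) : cosMellin w ≠ 0 := by
  have hw : w ≠ 0 := fun h ↦ by simp [h] at h0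
  refine mul_ne_zero (div_ne_zero (Complex.Gamma_ne_zero_of_re_pos (by simpa using h1)) hw)
    (mul_ne_zero ?_ ?_)
  · rw [Complex.cpow_def_of_ne_zero (by simp [Real.pi_ne_zero])]
    exact Complex.exp_ne_zero _
  · rw [Ne, Complex.cos_eq_zero_iff]
    rintro ⟨k, hk⟩
    have hπ : (π : ℂ) ≠ 0 := by exact_mod_cast Real.pi_ne_zero
    have hwk : w = ((2 * k + 1 : ℤ) : ℂ) := by
      field_simp at hk
      push_cast
      linear_combination hk
    have hre : w.re = ((2 * k + 1 : ℤ) : ℝ) := by rw [hwk, Complex.intCast_re]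
    rw [hre] at h0 h1
    have h0' : 0 < 2 * k + 1 := by exact_mod_cast h0
    have h1' : 2 * k + 1 < 1 := by exact_mod_cast h1
    omega

lemma one_sub_cos_eq_oneSubExp (u : ℝ) : ((1 - Real.cos (2 * π * u) : ℝ) : ℂ) =
    (oneSubExp (2 * π * Complex.I) u + oneSubExp (-(2 * π * Complex.I)) u) / 2 := by
  simp only [oneSubExp, Complex.ofReal_sub, Complex.ofReal_one, Complex.ofReal_cos, Complex.cos]
  rw [show (-(u * (2 * π * Complex.I)) : ℂ) = -((2 * π * u : ℝ) : ℂ) * Complex.I by push_cast; ring,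
    show (-(u * -(2 * π * Complex.I)) : ℂ) = ((2 * π * u : ℝ) : ℂ) * Complex.I by push_cast; ring]
  ring

lemma hasMellin_one_sub_cos {w : ℂ} (h0 : 0 < w.re) (h1 : w.re < 1) :
    HasMellin (fun u : ℝ ↦ ((1 - Real.cos (2 * π * u) : ℝ) : ℂ)) (-w) (cosMellin w) := by
  have hne : (2 * π * Complex.I : ℂ) ≠ 0 := by simp [Real.pi_ne_zero]
  have hp := mellinConvergent_oneSubExp (z := 2 * π * Complex.I) (by simp) h0 h1
  have hn := mellinConvergent_oneSubExp (z := -(2 * π * Complex.I)) (by simp) h0 h1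
  have h := hasMellin_add hp hn
  simp_rw [one_sub_cos_eq_oneSubExp]
  refine ⟨h.1.div_const 2, ?_⟩
  rw [mellin_div_const, h.2, mellin_oneSubExp (by simp) hne h0 h1,
    mellin_oneSubExp (by simp) (neg_ne_zero.2 hne) h0 h1, ← mul_add, two_pi_mul_I_cpow_add,
    cosMellin]
  ring

/-! ### From the estimate to the Riemann Hypothesis -/

/-- The reciprocal of the zeta function, with its value `0` at the pole `s = 1`. -/
noncomputable def invZeta (s : ℂ) : ℂ := (s - 1) / riemannZeta₁ s

lemma riemannZeta₁_eq {s : ℂ} (hs : s ≠ 1) : riemannZeta₁ s = (s - 1) * riemannZeta s := by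
  rw [riemannZeta_eq_inv_sub_mul hs, mul_inv_cancel_left₀ (sub_ne_zero.2 hs)]

lemma invZeta_eq_inv {s : ℂ} (hs : s ≠ 1) : invZeta s = (riemannZeta s)⁻¹ := by
  rw [invZeta, riemannZeta₁_eq hs, div_mul_cancel_left₀ (sub_ne_zero.2 hs)]

lemma riemannZeta₁_ne_zero_of_one_le_re {s : ℂ} (hs : 1 ≤ s.re) : riemannZeta₁ s ≠ 0 := by
  rcases eq_or_ne s 1 with rfl | h
  · simp
  · rw [riemannZeta₁_eq h]
    exact mul_ne_zero (sub_ne_zero.2 h) (riemannZeta_ne_zero_of_one_le_re hs)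

lemma norm_moebiusCoeff_mul_cpow_le (n : ℕ) (w : ℂ) :
    ‖(moebiusCoeff n : ℂ) * (n : ℂ) ^ w‖ ≤ (n : ℝ) ^ (w.re - 3 / 2) := by
  rcases Nat.eq_zero_or_pos n with rfl | hn
  · have : moebiusCoeff 0 = 0 := by simp [moebiusCoeff]
    rw [this, Complex.ofReal_zero, zero_mul, norm_zero]
    positivity
  · have hn' : (0 : ℝ) < n := by exact_mod_cast hn
    rw [norm_mul, Complex.norm_real, Complex.norm_natCast_cpow_of_pos hn, Real.norm_eq_abs,
      sub_eq_add_neg, Real.rpow_add hn', mul_comm]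
    gcongr
    exact abs_moebiusCoeff_le n

lemma hasSum_moebiusCoeff_mul_cpow {w : ℂ} (hw : w.re < 1 / 2) :
    HasSum (fun n : ℕ ↦ (moebiusCoeff n : ℂ) * (n : ℂ) ^ w) (invZeta (3 / 2 - w)) := by
  have hre : 1 < (3 / 2 - w).re := by
    have : (3 / 2 - w).re = 3 / 2 - w.re := by simp
    rw [this]
    linarith
  have hne : (3 / 2 - w) ≠ 1 := fun h ↦ by simp [h] at hre
  have hsum : LSeriesSummable (fun n ↦ (μ n : ℂ)) (3 / 2 - w) :=
    ArithmeticFunction.LSeriesSummable_moebius_iff.2 hre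
  have hval : LSeries (fun n ↦ (μ n : ℂ)) (3 / 2 - w) = invZeta (3 / 2 - w) := by
    have h := ArithmeticFunction.LSeries_zeta_mul_Lseries_moebius hre
    rw [ArithmeticFunction.LSeries_zeta_eq_riemannZeta hre] at h
    rw [invZeta_eq_inv hne]
    exact eq_inv_of_mul_eq_one_right h
  rw [← hval]
  refine hsum.LSeriesHasSum.congr_fun fun n ↦ ?_
  rcases Nat.eq_zero_or_pos n with rfl | hn
  · simp [moebiusCoeff]
  · have hn' : (n : ℂ) ≠ 0 := by exact_mod_cast hn.ne'
    rw [LSeries.term_of_ne_zero hn.ne', moebiusCoeff, Complex.ofReal_mul, Complex.ofReal_intCast,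
      Complex.ofReal_cpow n.cast_nonneg, Complex.ofReal_natCast, mul_assoc,
      ← Complex.cpow_add _ _ hn', div_eq_mul_inv (μ n : ℂ), ← Complex.cpow_neg]
    congr 2
    push_cast
    ring

/-- `∑ μ(n) n^{-3/2} (1 - cos 2πny)`, the real part of `P` on the imaginary axis. -/
noncomputable def moebiusCosSum (y : ℝ) : ℝ :=
  ∑' n : ℕ, moebiusCoeff n * (1 - Real.cos (2 * π * (n * y)))

lemma norm_moebiusCoeff_mul_one_sub_cos_le (n : ℕ) (y : ℝ) :
    ‖moebiusCoeff n * (1 - Real.cos (2 * π * (n * y)))‖ ≤ (n : ℝ) ^ (-(3 / 2) : ℝ) * 2 := by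
  have h0 := Real.neg_one_le_cos (2 * π * (n * y))
  have h1 := Real.cos_le_one (2 * π * (n * y))
  rw [norm_mul, Real.norm_eq_abs, Real.norm_eq_abs]
  gcongr
  · exact abs_moebiusCoeff_le n
  · rw [abs_le]
    constructor <;> linarith

lemma summable_rpow_neg_three_half_mul_two :
    Summable fun n : ℕ ↦ (n : ℝ) ^ (-(3 / 2) : ℝ) * 2 :=
  (Real.summable_nat_rpow.2 (by norm_num)).mul_right 2

lemma continuous_moebiusCosSum : Continuous moebiusCosSum :=
  continuous_tsum (fun n ↦ by fun_prop) summable_rpow_neg_three_half_mul_two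
    norm_moebiusCoeff_mul_one_sub_cos_le

lemma exists_abs_moebiusCosSum_le : ∃ C, ∀ y, |moebiusCosSum y| ≤ C :=
  ⟨_, fun y ↦ tsum_of_norm_bounded summable_rpow_neg_three_half_mul_two.hasSum
    fun n ↦ norm_moebiusCoeff_mul_one_sub_cos_le n y⟩

lemma moebiusCosSum_isBigO_top :
    (fun y ↦ (moebiusCosSum y : ℂ)) =O[atTop] fun y : ℝ ↦ y ^ (-(0 : ℝ)) := by
  obtain ⟨C, hC⟩ := exists_abs_moebiusCosSum_le
  refine IsBigO.of_bound C (.of_forall fun y ↦ ?_)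
  simpa using hC y

lemma CriterionBound.isBigO_moebiusCosSum {δ : ℝ} (h : CriterionBound δ) :
    (fun y ↦ (moebiusCosSum y : ℂ)) =O[𝓝[>] 0] fun y : ℝ ↦ y ^ (-(-(δ + 1))) := by
  have h1 := (h.comp_tendsto tendsto_inv_nhdsGT_zero).const_mul_left (-(2 * π ^ 2))
  have h2 : (fun y ↦ moebiusCosSum y) =O[𝓝[>] 0] fun y : ℝ ↦ y ^ (-(-(δ + 1))) := by
    refine h1.congr' (.of_forall fun y ↦ ?_) ?_
    · simp only [Function.comp_apply, tsum_criterionTerm, moebiusExpSum_mul_I_re, inv_inv,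
        moebiusCosSum]
      rw [← mul_assoc, show -(2 * π ^ 2) * -(1 / (2 * π ^ 2)) = 1 by field_simp, one_mul]
    · filter_upwards [self_mem_nhdsWithin] with y hy
      have hy : 0 < y := hy
      simp only [Function.comp_apply]
      rw [Real.inv_rpow hy.le, ← Real.rpow_neg hy.le]
      congr 1
      ring
  refine (IsBigO.of_norm_left ?_)
  simpa using h2.norm_left

open MeasureTheory Set in
/-- For `0 < Re w < 1/2` the Mellin transform may be computed term by term. -/
lemma mellin_moebiusCosSum {w : ℂ} (h0 : 0 < w.re) (h1 : w.re < 1 / 2) :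
    mellin (fun y ↦ (moebiusCosSum y : ℂ)) (-w) = cosMellin w * invZeta (3 / 2 - w) := by
  set f : ℝ → ℂ := fun u ↦ ((1 - Real.cos (2 * π * u) : ℝ) : ℂ) with hf
  have hM := hasMellin_one_sub_cos h0 (by linarith : w.re < 1)
  have hterm (n : ℕ) : HasMellin (fun u : ℝ ↦ (moebiusCoeff n : ℂ) * f (n * u)) (-w)
      (moebiusCoeff n * (n : ℂ) ^ w * cosMellin w) := by
    rcases Nat.eq_zero_or_pos n with rfl | hn
    · have : moebiusCoeff 0 = 0 := by simp [moebiusCoeff]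
      simp [this, HasMellin, MellinConvergent, mellin]
    · have hn' : (0 : ℝ) < n := by exact_mod_cast hn
      have hc : MellinConvergent (fun u ↦ f (n * u)) (-w) :=
        (MellinConvergent.comp_mul_left hn').2 hM.1
      have := hasMellin_const_smul hc (moebiusCoeff n : ℂ)
      refine ⟨this.1, ?_⟩
      have h2 := this.2
      rw [mellin_comp_mul_left _ _ hn', hM.2, neg_neg, smul_eq_mul, smul_eq_mul,
        Complex.ofReal_natCast, ← mul_assoc] at h2
      exact h2
  have hnorm (n : ℕ) : ∫ u in Ioi (0 : ℝ), ‖(u : ℂ) ^ (-w - 1) • ((moebiusCoeff n : ℂ) * f (n * u))‖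
      ≤ (n : ℝ) ^ (w.re - 3 / 2) * ∫ u in Ioi (0 : ℝ), ‖(u : ℂ) ^ (-w - 1) • f u‖ := by
    rcases Nat.eq_zero_or_pos n with rfl | hn
    · have : moebiusCoeff 0 = 0 := by simp [moebiusCoeff]
      simp only [this, Complex.ofReal_zero, zero_mul, smul_zero, norm_zero, integral_zero]
      positivity
    · have hn' : (0 : ℝ) < n := by exact_mod_cast hn
      have hsc := integral_comp_mul_left_Ioi (fun u : ℝ ↦ ‖(u : ℂ) ^ (-w - 1) • f u‖) 0 hn'
      rw [mul_zero, smul_eq_mul] at hsc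
      have heq : ∫ u in Ioi (0 : ℝ), ‖(u : ℂ) ^ (-w - 1) • ((moebiusCoeff n : ℂ) * f (n * u))‖ =
          |moebiusCoeff n| * (n : ℝ) ^ (w.re + 1) *
            ∫ u in Ioi (0 : ℝ), ‖((n * u : ℝ) : ℂ) ^ (-w - 1) • f (n * u)‖ := by
        rw [← integral_const_mul]
        refine setIntegral_congr_fun measurableSet_Ioi fun u hu ↦ ?_
        have hu : 0 < u := hu
        simp only [norm_smul, norm_mul, Complex.norm_real, Real.norm_eq_abs]
        rw [Complex.norm_cpow_eq_rpow_re_of_pos hu,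
          Complex.norm_cpow_eq_rpow_re_of_pos (by positivity), Complex.sub_re, Complex.neg_re,
          Complex.one_re, Real.mul_rpow hn'.le hu.le]
        have : (n : ℝ) ^ (w.re + 1) * (n : ℝ) ^ (-w.re - 1) = 1 := by
          rw [← Real.rpow_add hn']
          simp
        linear_combination (-|moebiusCoeff n| * u ^ (-w.re - 1) * ‖f (n * u)‖) * this
      rw [heq, hsc, ← mul_assoc, mul_assoc |moebiusCoeff n|, Real.rpow_add_one hn'.ne',
        mul_inv_cancel_right₀ hn'.ne', sub_eq_add_neg w.re, Real.rpow_add hn', mul_comm (_ ^ w.re)]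
      gcongr
      exact abs_moebiusCoeff_le n
  have hs : Summable fun n : ℕ ↦
      ∫ u in Ioi (0 : ℝ), ‖(u : ℂ) ^ (-w - 1) • ((moebiusCoeff n : ℂ) * f (n * u))‖ :=
    Summable.of_nonneg_of_le (fun n ↦ integral_nonneg fun u ↦ norm_nonneg _) hnorm
      ((Real.summable_nat_rpow.2 (by linarith)).mul_right _)
  have hint := hasSum_integral_of_summable_integral_norm (fun n ↦ (hterm n).1) hs
  have hval : mellin (fun y ↦ (moebiusCosSum y : ℂ)) (-w) = ∫ u in Ioi (0 : ℝ), ∑' n : ℕ,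
      (u : ℂ) ^ (-w - 1) • ((moebiusCoeff n : ℂ) * f (n * u)) := by
    refine setIntegral_congr_fun measurableSet_Ioi fun u _ ↦ ?_
    simp only [smul_eq_mul]
    rw [tsum_mul_left, moebiusCosSum, Complex.ofReal_tsum]
    simp [hf]
  rw [hval, ← hint.tsum_eq, mul_comm, ← (hasSum_moebiusCoeff_mul_cpow h1).tsum_eq,
    ← tsum_mul_right]
  exact tsum_congr fun n ↦ (hterm n).2

lemma differentiableOn_cosMellin : DifferentiableOn ℂ cosMellin {w | 0 < w.re ∧ w.re < 1} := by
  rintro w ⟨h0, h1⟩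
  have hw : w ≠ 0 := fun h ↦ by simp [h] at h0
  have hG : DifferentiableAt ℂ (fun w ↦ Complex.Gamma (1 - w)) w := by
    refine DifferentiableAt.comp w (Complex.differentiableAt_Gamma _ fun m h ↦ ?_) (by fun_prop)
    have : (1 - w).re = -(m : ℝ) := by rw [h]; simp
    have hm : (0 : ℝ) ≤ m := m.cast_nonneg
    simp at this
    linarith
  have hc : DifferentiableAt ℂ (fun w ↦ (2 * π : ℂ) ^ w) w :=
    differentiableAt_id.const_cpow (Or.inl (by simp [Real.pi_ne_zero]))
  exact ((hG.div differentiableAt_id hw).mul (hc.mul (by fun_prop))).differentiableWithinAt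

/-- The analytic continuation of the Mellin transform to `0 < Re w < 1` forces `ζ` to have no zeros
with real part between `1/2` and `1`. -/
lemma riemannZeta_ne_zero_of_criterionBound (h : ∀ δ : ℝ, δ < 0 → CriterionBound δ) {ρ : ℂ}
    (h0 : 1 / 2 < ρ.re) (h1 : ρ.re < 1) : riemannZeta ρ ≠ 0 := by
  intro hρ
  set U : Set ℂ := {w | 0 < w.re ∧ w.re < 1} with hU
  have hopen : IsOpen U := (isOpen_lt continuous_const Complex.continuous_re).inter
    (isOpen_lt Complex.continuous_re continuous_const)
  have hconn : IsPreconnected U :=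
    ((convex_halfSpace_re_gt 0).inter (convex_halfSpace_re_lt 1)).isPreconnected
  have hmellin : DifferentiableOn ℂ (fun w ↦ mellin (fun y ↦ (moebiusCosSum y : ℂ)) (-w)) U := by
    rintro w ⟨hw0, hw1⟩
    have hd : DifferentiableAt ℂ (mellin (fun y ↦ (moebiusCosSum y : ℂ))) (-w) := by
      -- any exponent strictly between `Re w` and `1` bounds the function near `0`
      refine mellin_differentiableAt_of_isBigO_rpow (a := 0) (b := -((w.re - 1) / 2 + 1)) ?_
        moebiusCosSum_isBigO_top (by simpa using hw0)
        (h ((w.re - 1) / 2) (by linarith)).isBigO_moebiusCosSum ?_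
      · exact (Complex.continuous_ofReal.comp
          continuous_moebiusCosSum).locallyIntegrable.locallyIntegrableOn _
      · rw [Complex.neg_re]
        linarith
    exact (hd.comp w differentiableAt_id.neg).differentiableWithinAt
  have hA : AnalyticOnNhd ℂ (fun w ↦ mellin (fun y ↦ (moebiusCosSum y : ℂ)) (-w) *
      riemannZeta₁ (3 / 2 - w)) U :=
    (hmellin.mul (by fun_prop)).analyticOnNhd hopen
  have hB : AnalyticOnNhd ℂ (fun w ↦ cosMellin w * (1 / 2 - w)) U :=
    (differentiableOn_cosMellin.mul (by fun_prop)).analyticOnNhd hopen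
  have heq : (fun w ↦ mellin (fun y ↦ (moebiusCosSum y : ℂ)) (-w) * riemannZeta₁ (3 / 2 - w))
      =ᶠ[𝓝 (1 / 4)] fun w ↦ cosMellin w * (1 / 2 - w) := by
    have hnhds : {w : ℂ | 0 < w.re ∧ w.re < 1 / 2} ∈ 𝓝 (1 / 4 : ℂ) := by
      refine ((isOpen_lt continuous_const Complex.continuous_re).inter
        (isOpen_lt Complex.continuous_re continuous_const)).mem_nhds ?_
      constructor <;> norm_num
    filter_upwards [hnhds] with w hw
    have hz : riemannZeta₁ (3 / 2 - w) ≠ 0 := by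
      refine riemannZeta₁_ne_zero_of_one_le_re ?_
      have : (3 / 2 - w).re = 3 / 2 - w.re := by simp
      rw [this]
      linarith [hw.2]
    rw [mellin_moebiusCosSum hw.1 hw.2, invZeta, mul_assoc, div_mul_cancel₀ _ hz]
    ring
  have hre : (3 / 2 - ρ).re = 3 / 2 - ρ.re := by simp
  have hmem : 3 / 2 - ρ ∈ U := by
    constructor <;> rw [hre] <;> linarith
  have key := hA.eqOn_of_preconnected_of_eventuallyEq hB hconn
    (by constructor <;> norm_num : (1 / 4 : ℂ) ∈ U) heq hmem
  have hρ1 : ρ ≠ 1 := fun h ↦ by simp [h] at h1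
  have hzero : riemannZeta₁ (3 / 2 - (3 / 2 - ρ)) = 0 := by
    rw [sub_sub_cancel, riemannZeta₁_eq hρ1, hρ, mul_zero]
  simp only [hzero, mul_zero] at key
  rcases mul_eq_zero.1 key.symm with h2 | h2
  · exact cosMellin_ne_zero hmem.1 hmem.2 h2
  · exact hρ1 (by linear_combination h2)

/-- By the functional equation, zeros to the left of the critical line are either trivial or mirror
images of zeros to its right. -/
lemma riemannHypothesis_of_ne_zero
    (h : ∀ ρ : ℂ, 1 / 2 < ρ.re → ρ.re < 1 → riemannZeta ρ ≠ 0) : RiemannHypothesis := by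
  have hright (ρ : ℂ) (hρ : 1 / 2 < ρ.re) : riemannZeta ρ ≠ 0 := by
    rcases lt_or_ge ρ.re 1 with h1 | h1
    · exact h ρ hρ h1
    · exact riemannZeta_ne_zero_of_one_le_re h1
  intro s hs htriv _
  rcases lt_trichotomy s.re (1 / 2) with hlt | heq | hgt
  · exfalso
    have hre : (1 - s).re = 1 - s.re := by simp
    have hs0 : s ≠ 0 := by
      rintro rfl
      rw [riemannZeta_zero] at hs
      norm_num at hs
    have hfe := riemannZeta_one_sub (s := 1 - s) (fun n hn ↦ by
      have h2 : (1 - s).re = -(n : ℝ) := by rw [hn]; simp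
      have hn0 : (0 : ℝ) ≤ n := n.cast_nonneg
      rw [hre] at h2
      linarith) (fun h2 ↦ hs0 (by linear_combination -h2))
    rw [sub_sub_cancel, hs] at hfe
    have hG : Complex.Gamma (1 - s) ≠ 0 :=
      Complex.Gamma_ne_zero_of_re_pos (by rw [hre]; linarith)
    have hpow : (2 * π : ℂ) ^ (-(1 - s)) ≠ 0 := by
      rw [Complex.cpow_def_of_ne_zero (by simp [Real.pi_ne_zero])]
      exact Complex.exp_ne_zero _
    have hz := hright (1 - s) (by rw [hre]; linarith)
    have hcos : Complex.cos (π * (1 - s) / 2) = 0 := by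
      by_contra hcos
      exact mul_ne_zero (mul_ne_zero (mul_ne_zero (mul_ne_zero two_ne_zero hpow) hG) hcos) hz
        hfe.symm
    obtain ⟨k, hk⟩ := Complex.cos_eq_zero_iff.1 hcos
    have hπ : (π : ℂ) ≠ 0 := by exact_mod_cast Real.pi_ne_zero
    have hsk : s = ((-2 * k : ℤ) : ℂ) := by
      field_simp at hk
      push_cast
      linear_combination -hk
    have hsre : s.re = ((-2 * k : ℤ) : ℝ) := by rw [hsk, Complex.intCast_re]
    have hk0 : 0 ≤ k := by
      by_contra hneg
      have : (1 : ℤ) ≤ -2 * k := by omega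
      have : (1 : ℝ) ≤ ((-2 * k : ℤ) : ℝ) := by exact_mod_cast this
      linarith
    have hk1 : k ≠ 0 := by
      rintro rfl
      exact hs0 (by simpa using hsk)
    obtain ⟨n, rfl⟩ : ∃ n : ℕ, k = n + 1 := ⟨(k - 1).toNat, by omega⟩
    exact htriv ⟨n, by rw [hsk]; push_cast; ring⟩
  · exact heq
  · exact absurd hs (hright s hgt)

theorem riemannHypothesis_of_criterionBound (h : ∀ δ : ℝ, δ < 0 → CriterionBound δ) :
    RiemannHypothesis :=
  riemannHypothesis_of_ne_zero fun _ ↦ riemannZeta_ne_zero_of_criterionBound h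

/-! ### Linear growth of the zeta function to the right of the critical line -/

/-- `∫_1^∞ {t} t^{-s-1} dt`, written as a Mellin transform. -/
noncomputable def fractMellin (s : ℂ) : ℂ :=
  mellin ((Set.Ioi (1 : ℝ)).indicator fun t : ℝ ↦ ((Int.fract t : ℝ) : ℂ)) (-s)

open MeasureTheory Set in
lemma fractMellin_eq_integral (s : ℂ) :
    fractMellin s = ∫ t in Ioi (1 : ℝ), (t : ℂ) ^ (-s - 1) * ((Int.fract t : ℝ) : ℂ) := by
  have h : EqOn (fun t : ℝ ↦ (t : ℂ) ^ (-s - 1) • (Ioi (1 : ℝ)).indicator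
      (fun t : ℝ ↦ ((Int.fract t : ℝ) : ℂ)) t)
      ((Ioi (1 : ℝ)).indicator fun t : ℝ ↦ (t : ℂ) ^ (-s - 1) * ((Int.fract t : ℝ) : ℂ)) (Ioi 0) := by
    intro t _
    by_cases ht : t ∈ Ioi (1 : ℝ) <;> simp [ht]
  rw [fractMellin, mellin, setIntegral_congr_fun measurableSet_Ioi h,
    setIntegral_indicator measurableSet_Ioi,
    inter_eq_self_of_subset_right (Ioi_subset_Ioi zero_le_one)]

lemma norm_cpow_mul_fract_le (s : ℂ) {t : ℝ} (ht : 0 < t) :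
    ‖(t : ℂ) ^ (-s - 1) * ((Int.fract t : ℝ) : ℂ)‖ ≤ t ^ (-s.re - 1) := by
  rw [norm_mul, Complex.norm_cpow_eq_rpow_re_of_pos ht, Complex.norm_real,
    Real.norm_of_nonneg (Int.fract_nonneg t)]
  simpa using mul_le_of_le_one_right (Real.rpow_nonneg ht.le _) (Int.fract_lt_one t).le

open MeasureTheory Set in
lemma integrableOn_cpow_mul_fract {s : ℂ} (hs : 0 < s.re) :
    IntegrableOn (fun t : ℝ ↦ (t : ℂ) ^ (-s - 1) * ((Int.fract t : ℝ) : ℂ)) (Ioi 1) := by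
  refine Integrable.mono' (integrableOn_Ioi_rpow_of_lt (a := -s.re - 1) (by linarith) zero_lt_one)
    ?_ ?_
  · exact (by fun_prop : Measurable
      fun t : ℝ ↦ (t : ℂ) ^ (-s - 1) * ((Int.fract t : ℝ) : ℂ)).aestronglyMeasurable
  · filter_upwards [ae_restrict_mem measurableSet_Ioi] with t ht
    exact norm_cpow_mul_fract_le s (zero_lt_one.trans ht)

open MeasureTheory Set in
lemma norm_fractMellin_le {s : ℂ} (hs : 0 < s.re) : ‖fractMellin s‖ ≤ 1 / s.re := by
  rw [fractMellin_eq_integral]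
  refine (norm_integral_le_of_norm_le
    (integrableOn_Ioi_rpow_of_lt (a := -s.re - 1) (by linarith) zero_lt_one) ?_).trans_eq ?_
  · filter_upwards [ae_restrict_mem measurableSet_Ioi] with t ht
    exact norm_cpow_mul_fract_le s (zero_lt_one.trans ht)
  · rw [integral_Ioi_rpow_of_lt (by linarith) zero_lt_one]
    simp [neg_div_neg_eq]

open MeasureTheory Set in
lemma differentiableOn_fractMellin : DifferentiableOn ℂ fractMellin {s | 0 < s.re} := by
  intro s hs
  have hs : 0 < s.re := hs
  have hd : DifferentiableAt ℂ
      (mellin ((Ioi (1 : ℝ)).indicator fun t : ℝ ↦ ((Int.fract t : ℝ) : ℂ))) (-s) := by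
    refine mellin_differentiableAt_of_isBigO_rpow (a := 0) (b := -s.re - 1) ?_ ?_
      (by simpa using hs) ?_ (by simp)
    · refine LocallyIntegrable.locallyIntegrableOn ?_ _
      refine (locallyIntegrable_const (1 : ℝ)).mono
        ((by fun_prop : Measurable fun t : ℝ ↦ ((Int.fract t : ℝ) : ℂ)).indicator
          measurableSet_Ioi).aestronglyMeasurable (.of_forall fun t ↦ ?_)
      refine (norm_indicator_le_norm_self _ _).trans ?_
      rw [Complex.norm_real, Real.norm_of_nonneg (Int.fract_nonneg t), norm_one]
      exact (Int.fract_lt_one t).le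
    · refine IsBigO.of_bound 1 (.of_forall fun t ↦ ?_)
      refine (norm_indicator_le_norm_self _ _).trans ?_
      rw [Complex.norm_real, Real.norm_of_nonneg (Int.fract_nonneg t)]
      simpa using (Int.fract_lt_one t).le
    · refine (EventuallyEq.trans_isBigO ?_ (isBigO_zero _ _))
      filter_upwards [Ioo_mem_nhdsGT (zero_lt_one (α := ℝ))] with t ht
      exact indicator_of_notMem (by simpa using ht.2.le) _
  exact (hd.comp s differentiableAt_id.neg).differentiableWithinAt

open MeasureTheory Set in
lemma riemannZeta₁_eq_of_one_lt_re {s : ℂ} (hs : 1 < s.re) :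
    riemannZeta₁ s = s - s * (s - 1) * fractMellin s := by
  have hs1 : s ≠ 1 := fun h ↦ by simp [h] at hs
  have hsub : s - 1 ≠ 0 := sub_ne_zero.2 hs1
  have hL := LSeries_eq_mul_integral (1 : ℕ → ℂ) zero_le_one hs
    (LSeriesSummable_one_iff.2 hs) (by
      simpa using isBigO_refl (fun n : ℕ ↦ (n : ℂ)) atTop |>.norm_right)
  rw [LSeries_one_eq_riemannZeta hs] at hL
  have hint : ∫ t in Ioi (1 : ℝ), (∑ k ∈ Finset.Icc 1 ⌊t⌋₊, (1 : ℕ → ℂ) k) * (t : ℂ) ^ (-(s + 1)) =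
      1 / (s - 1) - fractMellin s := by
    have h1 : ∫ t in Ioi (1 : ℝ), (t : ℂ) ^ (-s) = 1 / (s - 1) := by
      rw [integral_Ioi_cpow_of_lt (a := -s) (by simpa using hs) zero_lt_one, Complex.ofReal_one,
        Complex.one_cpow, show -s + 1 = -(s - 1) by ring, neg_div_neg_eq]
    rw [← h1, fractMellin_eq_integral, ← integral_sub
      (integrableOn_Ioi_cpow_of_lt (a := -s) (by simpa using hs) zero_lt_one)
      (integrableOn_cpow_mul_fract (by linarith))]
    refine setIntegral_congr_fun measurableSet_Ioi fun t ht ↦ ?_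
    have ht0 : 0 < t := zero_lt_one.trans ht
    have ht' : (t : ℂ) ≠ 0 := by exact_mod_cast ht0.ne'
    have hfl : ((⌊t⌋₊ : ℕ) : ℂ) = t - Int.fract t := by
      have h2 : ((⌊t⌋₊ : ℕ) : ℝ) = t - Int.fract t := by
        rw [natCast_floor_eq_intCast_floor ht0.le, Int.self_sub_fract]
      rw [← Complex.ofReal_natCast, h2, Complex.ofReal_sub]
    have hpow : (t : ℂ) ^ (-s) = (t : ℂ) ^ (-s - 1) * t := by
      rw [Complex.cpow_sub _ _ ht', Complex.cpow_one, div_mul_cancel₀ _ ht']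
    simp only [Pi.one_apply, Finset.sum_const, Nat.card_Icc, add_tsub_cancel_right, nsmul_eq_mul,
      mul_one]
    rw [hfl, hpow, neg_add']
    ring
  rw [riemannZeta₁_eq hs1, hL, hint]
  field_simp

lemma riemannZeta₁_eq_of_re_pos {s : ℂ} (hs : 0 < s.re) :
    riemannZeta₁ s = s - s * (s - 1) * fractMellin s := by
  have hopen : IsOpen {s : ℂ | 0 < s.re} := isOpen_lt continuous_const Complex.continuous_re
  have hL : AnalyticOnNhd ℂ riemannZeta₁ {s | 0 < s.re} :=
    differentiable_riemannZeta₁.differentiableOn.analyticOnNhd hopen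
  have hR : AnalyticOnNhd ℂ (fun s ↦ s - s * (s - 1) * fractMellin s) {s | 0 < s.re} := by
    refine DifferentiableOn.analyticOnNhd ?_ hopen
    have := differentiableOn_fractMellin
    fun_prop
  refine hL.eqOn_of_preconnected_of_eventuallyEq hR (convex_halfSpace_re_gt 0).isPreconnected
    (z₀ := 2) (by simp) ?_ hs
  filter_upwards [(isOpen_lt continuous_const Complex.continuous_re).mem_nhds
    (by simp : (2 : ℂ) ∈ {s : ℂ | 1 < s.re})] with s hs
  exact riemannZeta₁_eq_of_one_lt_re hs

lemma norm_riemannZeta_le {s : ℂ} (hre : 1 / 2 ≤ s.re) (him : 1 ≤ |s.im|) :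
    ‖riemannZeta s‖ ≤ 3 * ‖s‖ := by
  have hs1 : s ≠ 1 := fun h ↦ by simp [h] at him; linarith
  have hsub : 1 ≤ ‖s - 1‖ := him.trans (by simpa using Complex.abs_im_le_norm (s - 1))
  have hJ : ‖fractMellin s‖ ≤ 2 := by
    refine (norm_fractMellin_le (by linarith)).trans ?_
    rw [div_le_iff₀ (by linarith)]
    linarith
  have h : ‖s - 1‖ * ‖riemannZeta s‖ ≤ ‖s‖ + ‖s‖ * ‖s - 1‖ * 2 := by
    rw [← norm_mul, ← riemannZeta₁_eq hs1, riemannZeta₁_eq_of_re_pos (by linarith)]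
    refine (norm_sub_le _ _).trans ?_
    rw [norm_mul, norm_mul]
    gcongr
  have h2 : ‖s - 1‖ * ‖riemannZeta s‖ ≤ ‖s - 1‖ * (3 * ‖s‖) := by
    nlinarith [norm_nonneg s]
  exact le_of_mul_le_mul_left h2 (by linarith)

/-! ### Littlewood's bound for the reciprocal of the zeta function -/

/-- A holomorphic function without zeros on a disc has a logarithm there. -/
lemma exists_eq_mul_exp_of_ne_zero {F : ℂ → ℂ} {c : ℂ} {R : ℝ} (hR : 0 < R)
    (hF : DifferentiableOn ℂ F (Metric.ball c R)) (h0 : ∀ z ∈ Metric.ball c R, F z ≠ 0) :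
    ∃ f : ℂ → ℂ, DifferentiableOn ℂ f (Metric.ball c R) ∧ f c = 0 ∧
      ∀ z ∈ Metric.ball c R, F z = F c * Complex.exp (f z) := by
  have hquot : DifferentiableOn ℂ (fun z ↦ deriv F z / F z) (Metric.ball c R) :=
    (hF.deriv Metric.isOpen_ball).div hF h0
  obtain ⟨g, hg⟩ := hquot.isExactOn_ball
  have hc : c ∈ Metric.ball c R := Metric.mem_ball_self hR
  refine ⟨fun z ↦ g z - g c, fun z hz ↦ ((hg z hz).sub_const _).differentiableAt.differentiableWithinAt,
    sub_self _, fun z hz ↦ ?_⟩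
  have hderiv (z : ℂ) (hz : z ∈ Metric.ball c R) :
      HasDerivAt (fun z ↦ F z * Complex.exp (-(g z - g c))) 0 z := by
    have h1 := (hF.differentiableAt (Metric.isOpen_ball.mem_nhds hz)).hasDerivAt
    have h2 := (((hg z hz).sub_const (g c)).neg).cexp
    refine (h1.mul h2).congr_deriv ?_
    have := h0 z hz
    field_simp
    ring
  have hconst := Metric.isOpen_ball.is_const_of_deriv_eq_zero
    (convex_ball c R).isPreconnected
    (fun z hz ↦ (hderiv z hz).differentiableAt.differentiableWithinAt)
    (fun z hz ↦ (hderiv z hz).deriv) hz hc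
  simp only [sub_self, neg_zero, Complex.exp_zero, mul_one] at hconst
  rw [← hconst, mul_assoc, ← Complex.exp_add, neg_add_cancel, Complex.exp_zero, mul_one]

/-- The Borel–Carathéodory theorem on a disc with arbitrary centre, for a function vanishing
there. -/
lemma norm_le_of_re_le {f : ℂ → ℂ} {c z : ℂ} {M R : ℝ} (hM : 0 < M)
    (hf : DifferentiableOn ℂ f (Metric.ball c R)) (hre : ∀ z ∈ Metric.ball c R, (f z).re ≤ M)
    (h0 : f c = 0) (hz : z ∈ Metric.ball c R) :
    ‖f z‖ ≤ 2 * M * ‖z - c‖ / (R - ‖z - c‖) := by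
  have hmaps : Set.MapsTo (fun w ↦ c + w) (Metric.ball 0 R) (Metric.ball c R) := fun w hw ↦ by
    simpa using hw
  have hR : 0 < R := Metric.pos_of_mem_ball hz
  have h := Complex.borelCaratheodory_zero (f := fun w ↦ f (c + w)) (z := z - c) hM
    (hf.comp (by fun_prop) hmaps) (fun w hw ↦ hre _ (hmaps hw)) hR
    (by simpa [dist_eq_norm] using hz) (by simpa using h0)
  simpa using h

/-- A quantitative two-constants estimate read off from the Taylor coefficients: the bound `m` on
the small circle controls the first `N` coefficients, the bound `M` on the large one the others. -/
lemma norm_le_geom_sum_add {f : ℂ → ℂ} {c z : ℂ} {m M r₁ r ρ R : ℝ} (hr₁ : 0 < r₁) (hr₁R : r₁ < R)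
    (hr : 0 < r) (hrR : r < R) (hρr : ρ < r) (hf : DifferentiableOn ℂ f (Metric.ball c R))
    (hm : ∀ z ∈ Metric.sphere c r₁, ‖f z‖ ≤ m) (hM : ∀ z ∈ Metric.sphere c r, ‖f z‖ ≤ M)
    (hm0 : 0 ≤ m) (hM0 : 0 ≤ M) (hz : ‖z - c‖ ≤ ρ) (N : ℕ) :
    ‖f z‖ ≤ m * ∑ k ∈ Finset.range N, (ρ / r₁) ^ k + M * ((ρ / r) ^ N / (1 - ρ / r)) := by
  have hρ : 0 ≤ ρ := (norm_nonneg _).trans hz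
  have hq0 : 0 ≤ ρ / r := by positivity
  have hq1 : ρ / r < 1 := (div_lt_one hr).2 hρr
  have hcl (r : ℝ) (h : r < R) : DiffContOnCl ℂ f (Metric.ball c r) :=
    (hf.mono (Metric.closedBall_subset_ball h)).diffContOnCl_ball subset_rfl
  have hterm (r B : ℝ) (hr : 0 < r) (hrR : r < R) (hB : ∀ z ∈ Metric.sphere c r, ‖f z‖ ≤ B)
      (hB0 : 0 ≤ B) (k : ℕ) :
      ‖((k.factorial : ℂ))⁻¹ • (z - c) ^ k • iteratedDeriv k f c‖ ≤ B * (ρ / r) ^ k := by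
    have h := Complex.norm_iteratedDeriv_le_of_forall_mem_sphere_norm_le k hr (hcl r hrR) hB
    have hk : (0 : ℝ) < k.factorial := by exact_mod_cast k.factorial_pos
    rw [norm_smul, norm_smul, norm_inv, norm_pow, Complex.norm_natCast]
    calc (k.factorial : ℝ)⁻¹ * (‖z - c‖ ^ k * ‖iteratedDeriv k f c‖)
        ≤ (k.factorial : ℝ)⁻¹ * (ρ ^ k * (k.factorial * B / r ^ k)) := by gcongr
      _ = B * (ρ / r) ^ k := by rw [div_pow]; field_simp
  have hzball : z ∈ Metric.ball c R := by
    rw [Metric.mem_ball, dist_eq_norm]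
    linarith
  have hsum := Complex.hasSum_taylorSeries_on_ball hf hzball
  have hgeo : HasSum (fun k : ℕ ↦ M * (ρ / r) ^ (k + N)) (M * ((ρ / r) ^ N / (1 - ρ / r))) := by
    have := (hasSum_geometric_of_lt_one hq0 hq1).mul_left (M * (ρ / r) ^ N)
    rw [mul_assoc, ← div_eq_mul_inv] at this
    refine this.congr_fun fun k ↦ ?_
    rw [pow_add]
    ring
  rw [← hsum.tsum_eq, ← hsum.summable.sum_add_tsum_nat_add N]
  refine (norm_add_le _ _).trans (add_le_add ?_ ?_)
  · rw [Finset.mul_sum]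
    exact (norm_sum_le _ _).trans (Finset.sum_le_sum fun k _ ↦ hterm r₁ m hr₁ hr₁R hm hm0 k)
  · exact tsum_of_norm_bounded hgeo fun k ↦ hterm r M hr hrR hM hM0 (k + N)

lemma RiemannHypothesis.riemannZeta₁_ne_zero (h : RiemannHypothesis) {s : ℂ} (hs : 1 / 2 < s.re) :
    riemannZeta₁ s ≠ 0 := by
  rcases eq_or_ne s 1 with rfl | h1
  · simp
  · rw [riemannZeta₁_eq h1]
    refine mul_ne_zero (sub_ne_zero.2 h1) fun hz ↦ ?_
    refine hs.ne' (h s hz ?_ h1)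
    rintro ⟨n, rfl⟩
    have h2 : (-2 * ((n : ℂ) + 1)).re = -2 * ((n : ℝ) + 1) := by simp
    have h3 : (0 : ℝ) ≤ n := n.cast_nonneg
    rw [h2] at hs
    linarith

lemma norm_invZeta_le_tsum {s : ℂ} {a : ℝ} (ha : 1 < a) (hs : a ≤ s.re) :
    ‖invZeta s‖ ≤ ∑' n : ℕ, (n : ℝ) ^ (-a) := by
  have h := hasSum_moebiusCoeff_mul_cpow (w := 3 / 2 - s) (by
    have : (3 / 2 - s).re = 3 / 2 - s.re := by simp
    rw [this]
    linarith)
  rw [sub_sub_cancel] at h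
  rw [← h.tsum_eq]
  refine tsum_of_norm_bounded (Real.summable_nat_rpow.2 (by linarith)).hasSum fun n ↦ ?_
  refine (norm_moebiusCoeff_mul_cpow_le n _).trans ?_
  have : (3 / 2 - s).re - 3 / 2 = -s.re := by simp
  rw [this]
  rcases Nat.eq_zero_or_pos n with rfl | hn
  · simp only [Nat.cast_zero]
    rw [Real.zero_rpow (by linarith), Real.zero_rpow (by linarith)]
  · exact Real.rpow_le_rpow_of_exponent_le (by exact_mod_cast hn) (by linarith)

lemma norm_riemannZeta_le_tsum {s : ℂ} {a : ℝ} (ha : 1 < a) (hs : a ≤ s.re) :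
    ‖riemannZeta s‖ ≤ ∑' n : ℕ, (n : ℝ) ^ (-a) := by
  rw [zeta_eq_tsum_one_div_nat_cpow (by linarith)]
  refine tsum_of_norm_bounded (Real.summable_nat_rpow.2 (by linarith)).hasSum fun n ↦ ?_
  rcases Nat.eq_zero_or_pos n with rfl | hn
  · have hs0 : s ≠ 0 := fun h ↦ by simp [h] at hs; linarith
    simp only [Nat.cast_zero]
    rw [Complex.zero_cpow hs0, Real.zero_rpow (by linarith)]
    simp
  · rw [norm_div, norm_one, Complex.norm_natCast_cpow_of_pos hn, one_div, ← Real.rpow_neg (by positivity)]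
    exact Real.rpow_le_rpow_of_exponent_le (by exact_mod_cast hn) (by linarith)

/-- Littlewood: under the Riemann Hypothesis `1 / ζ(s)` grows more slowly than any power of `|t|` to
the right of the critical line. On a disc about `2 + it` the logarithm of `ζ` is `O(log |t|)` by
Borel–Carathéodory, and `O(1)` on a smaller concentric disc; interpolating between the two leaves an
arbitrarily small multiple of `log |t|`. -/
lemma RiemannHypothesis.norm_invZeta_le_of_le_abs_im (h : RiemannHypothesis) {ε η : ℝ} (hε : 0 < ε)
    (hε1 : ε < 1) (hη : 0 < η) : ∃ C, 0 ≤ C ∧ ∀ s : ℂ, 1 / 2 + ε ≤ s.re → s.re ≤ 2 → 4 ≤ |s.im| →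
      ‖invZeta s‖ ≤ C * |s.im| ^ η := by
  set A : ℝ := ∑' n : ℕ, (n : ℝ) ^ (-2 : ℝ) + 1 with hA
  set B : ℝ := ∑' n : ℕ, (n : ℝ) ^ (-(5 / 4) : ℝ) with hB
  have hA1 : 1 ≤ A := by
    have : 0 ≤ ∑' n : ℕ, (n : ℝ) ^ (-2 : ℝ) := tsum_nonneg fun n ↦ by positivity
    linarith
  have hB0 : 0 ≤ B := tsum_nonneg fun n ↦ by positivity
  set r : ℝ := 3 / 2 - ε / 2 with hr
  set ρ : ℝ := 3 / 2 - ε with hρ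
  have hr0 : 0 < r := by linarith
  have hq0 : 0 ≤ ρ / r := div_nonneg (by linarith) hr0.le
  have hq1 : ρ / r < 1 := (div_lt_one hr0).2 (by linarith)
  -- `N` is so large that the tail of the Taylor series contributes at most `η log |t|`
  obtain ⟨N, hN⟩ : ∃ N : ℕ, 6 / ε * ((ρ / r) ^ N / (1 - ρ / r)) ≤ η := by
    have ht : Tendsto (fun N : ℕ ↦ 6 / ε * ((ρ / r) ^ N / (1 - ρ / r))) atTop (𝓝 0) := by
      simpa using ((tendsto_pow_atTop_nhds_zero_of_lt_one hq0 hq1).div_const _).const_mul (6 / ε)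
    exact ((ht.eventually (gt_mem_nhds hη)).exists).imp fun N h ↦ le_of_lt h
  set K : ℝ := 4 * Real.log (A * B + 2) * ∑ k ∈ Finset.range N, (ρ / (1 / 2)) ^ k with hK
  refine ⟨A * Real.exp (K + η * Real.log (9 * A)), by positivity, fun s hs1 hs2 hs3 ↦ ?_⟩
  set t : ℝ := s.im with ht
  have ht0 : 0 < |t| := by linarith
  set p : ℂ := 2 + t * Complex.I with hp
  have hpre : p.re = 2 := by simp [hp]
  have hpim : p.im = t := by simp [hp]
  have hballre (z : ℂ) {R : ℝ} (hz : z ∈ Metric.ball p R) : |z.re - 2| < R := by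
    have h1 := Complex.abs_re_le_norm (z - p)
    rw [Complex.sub_re, hpre] at h1
    rw [Metric.mem_ball, dist_eq_norm] at hz
    linarith
  have hballim (z : ℂ) {R : ℝ} (hz : z ∈ Metric.ball p R) : |z.im - t| < R := by
    have h1 := Complex.abs_im_le_norm (z - p)
    rw [Complex.sub_im, hpim] at h1
    rw [Metric.mem_ball, dist_eq_norm] at hz
    linarith
  have him (z : ℂ) (hz : z ∈ Metric.ball p (3 / 2)) : 1 ≤ |z.im| := by
    have h1 := hballim z hz
    have h2 := abs_sub_abs_le_abs_sub t z.im
    rw [abs_sub_comm] at h2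
    linarith
  have hne1 (z : ℂ) (hz : z ∈ Metric.ball p (3 / 2)) : z ≠ 1 := fun h1 ↦ by
    have := him z hz
    simp [h1] at this
    linarith
  have hzeta (z : ℂ) (hz : z ∈ Metric.ball p (3 / 2)) : riemannZeta z ≠ 0 := fun h0 ↦ by
    refine h.riemannZeta₁_ne_zero (s := z) ?_ (by rw [riemannZeta₁_eq (hne1 z hz), h0, mul_zero])
    linarith [abs_lt.1 (hballre z hz)]
  obtain ⟨f, hfd, hfp, hf⟩ := exists_eq_mul_exp_of_ne_zero (by norm_num : (0 : ℝ) < 3 / 2)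
    (fun z hz ↦ (differentiableAt_riemannZeta (hne1 z hz)).differentiableWithinAt) hzeta
  have hpball : p ∈ Metric.ball p (3 / 2) := Metric.mem_ball_self (by norm_num)
  have hp0 := hzeta p hpball
  have hpA : ‖(riemannZeta p)⁻¹‖ ≤ A := by
    rw [← invZeta_eq_inv (hne1 p hpball)]
    exact (norm_invZeta_le_tsum one_lt_two hpre.ge).trans (by linarith)
  have hexp (z : ℂ) (hz : z ∈ Metric.ball p (3 / 2)) :
      Real.exp (f z).re ≤ A * ‖riemannZeta z‖ := by
    rw [← Complex.norm_exp]
    have : Complex.exp (f z) = (riemannZeta p)⁻¹ * riemannZeta z := by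
      rw [hf z hz, inv_mul_cancel_left₀ hp0]
    rw [this, norm_mul]
    gcongr
  set M : ℝ := Real.log (9 * A * |t|) with hM
  have hM0 : 0 < M := Real.log_pos (by nlinarith)
  have hreM (z : ℂ) (hz : z ∈ Metric.ball p (3 / 2)) : (f z).re ≤ M := by
    rw [hM, Real.le_log_iff_exp_le (by positivity)]
    have h1 := abs_lt.1 (hballre z hz)
    have h2 : ‖z‖ ≤ 3 * |t| := by
      refine (Complex.norm_le_abs_re_add_abs_im z).trans ?_
      have h3 := abs_sub_abs_le_abs_sub z.im t
      have h4 := hballim z hz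
      rw [abs_of_pos (by linarith : 0 < z.re)]
      linarith
    calc Real.exp (f z).re ≤ A * ‖riemannZeta z‖ := hexp z hz
      _ ≤ A * (3 * (3 * |t|)) := by
        gcongr
        exact (norm_riemannZeta_le (by linarith) (him z hz)).trans (by gcongr)
      _ = 9 * A * |t| := by ring
  set M' : ℝ := Real.log (A * B + 2) with hM'
  have hM'0 : 0 < M' := Real.log_pos (by nlinarith [mul_nonneg (zero_le_one.trans hA1) hB0])
  have hsub : Metric.ball p (3 / 4) ⊆ Metric.ball p (3 / 2) := Metric.ball_subset_ball (by norm_num)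
  have hreM' (z : ℂ) (hz : z ∈ Metric.ball p (3 / 4)) : (f z).re ≤ M' := by
    rw [hM', Real.le_log_iff_exp_le (by positivity)]
    have h1 := abs_lt.1 (hballre z hz)
    calc Real.exp (f z).re ≤ A * ‖riemannZeta z‖ := hexp z (hsub hz)
      _ ≤ A * B := by
        gcongr
        exact norm_riemannZeta_le_tsum (by norm_num) (by linarith)
      _ ≤ A * B + 2 := by linarith
  have hbig (z : ℂ) (hz : z ∈ Metric.sphere p r) : ‖f z‖ ≤ 6 / ε * M := by
    have hzn : ‖z - p‖ = r := by rwa [mem_sphere_iff_norm] at hz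
    have h1 := norm_le_of_re_le hM0 hfd hreM hfp (z := z)
      (by rw [Metric.mem_ball, dist_eq_norm, hzn]; linarith)
    rw [hzn] at h1
    refine h1.trans ?_
    rw [show (3 / 2 - r) = ε / 2 by rw [hr]; ring, div_le_iff₀ (by positivity)]
    calc 2 * M * r ≤ 2 * M * (3 / 2) := by gcongr; linarith
      _ = 6 / ε * M * (ε / 2) := by field_simp; ring
  have hsmall (z : ℂ) (hz : z ∈ Metric.sphere p (1 / 2)) : ‖f z‖ ≤ 4 * M' := by
    have hzn : ‖z - p‖ = 1 / 2 := by rwa [mem_sphere_iff_norm] at hz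
    have h1 := norm_le_of_re_le hM'0 (hfd.mono hsub) hreM' hfp (z := z)
      (by rw [Metric.mem_ball, dist_eq_norm, hzn]; norm_num)
    rw [hzn] at h1
    refine h1.trans (le_of_eq ?_)
    norm_num
    ring
  have hsp : ‖s - p‖ ≤ ρ := by
    have : s - p = ((s.re - 2 : ℝ) : ℂ) := by
      apply Complex.ext <;> simp [hp, ht]
    rw [this, Complex.norm_real, Real.norm_eq_abs, abs_le]
    constructor <;> linarith
  have hsball : s ∈ Metric.ball p (3 / 2) := by
    rw [Metric.mem_ball, dist_eq_norm]
    linarith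
  have hfs := norm_le_geom_sum_add (N := N) (by norm_num) (by norm_num) hr0 (by linarith)
    (by linarith : ρ < r) hfd hsmall hbig (by positivity) (by positivity) hsp
  have hfs' : ‖f s‖ ≤ K + η * M := by
    refine hfs.trans (add_le_add (le_of_eq hK.symm) ?_)
    calc 6 / ε * M * ((ρ / r) ^ N / (1 - ρ / r)) = 6 / ε * ((ρ / r) ^ N / (1 - ρ / r)) * M := by
          ring
      _ ≤ η * M := by gcongr
  have hinv : invZeta s = (riemannZeta p)⁻¹ * Complex.exp (-f s) := by
    rw [invZeta_eq_inv (hne1 s hsball), hf s hsball, mul_inv, Complex.exp_neg]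
  rw [hinv, norm_mul, Complex.norm_exp, mul_assoc]
  refine mul_le_mul hpA ?_ (by positivity) (by positivity)
  have hlog : M = Real.log (9 * A) + Real.log |t| := by
    rw [hM, Real.log_mul (by positivity) ht0.ne']
  rw [Real.rpow_def_of_pos ht0, ← Real.exp_add]
  refine Real.exp_le_exp.2 ?_
  have h5 := (abs_le.1 (Complex.abs_re_le_norm (f s))).1
  rw [hlog] at hfs'
  rw [Complex.neg_re]
  linarith

lemma RiemannHypothesis.norm_invZeta_le (h : RiemannHypothesis) {ε η : ℝ} (hε : 0 < ε)
    (hε1 : ε < 1) (hη : 0 < η) : ∃ C, 0 ≤ C ∧ ∀ s : ℂ, 1 / 2 + ε ≤ s.re → s.re ≤ 2 →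
      ‖invZeta s‖ ≤ C * (1 + |s.im|) ^ η := by
  obtain ⟨C₁, hC₁, hbig⟩ := h.norm_invZeta_le_of_le_abs_im hε hε1 hη
  have hcomp : IsCompact (Set.Icc (1 / 2 + ε) 2 ×ℂ Set.Icc (-4) 4) :=
    isCompact_Icc.reProdIm isCompact_Icc
  have hcont : ContinuousOn invZeta (Set.Icc (1 / 2 + ε) 2 ×ℂ Set.Icc (-4) 4) := by
    refine ContinuousOn.div (by fun_prop)
      differentiable_riemannZeta₁.continuous.continuousOn fun s hs ↦ ?_
    exact h.riemannZeta₁_ne_zero (by linarith [(Complex.mem_reProdIm.1 hs).1.1])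
  obtain ⟨C₂, hC₂⟩ := hcomp.exists_bound_of_continuousOn hcont
  refine ⟨max C₁ C₂, le_max_of_le_left hC₁, fun s hs1 hs2 ↦ ?_⟩
  rcases le_or_gt 4 |s.im| with h4 | h4
  · refine (hbig s hs1 hs2 h4).trans ?_
    gcongr
    · exact le_max_left _ _
    · linarith
  · refine (hC₂ s (Complex.mem_reProdIm.2 ⟨⟨hs1, hs2⟩, ?_⟩)).trans ?_
    · exact abs_le.1 h4.le
    · refine (le_max_right C₁ C₂).trans (le_mul_of_one_le_right (le_max_of_le_left hC₁) ?_)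
      exact Real.one_le_rpow (by linarith [abs_nonneg s.im]) hη.le

/-! ### The Gamma function on vertical lines -/

/-- The squared modulus `u² / |u + it|²` of the factors in Euler's product for `Γ`. -/
noncomputable def eulerFactor (t u : ℝ) : ℝ := u ^ 2 / (u ^ 2 + t ^ 2)

lemma eulerFactor_nonneg (t u : ℝ) : 0 ≤ eulerFactor t u := by
  unfold eulerFactor
  positivity

lemma eulerFactor_le_eulerFactor (t : ℝ) {u v : ℝ} (hu : 0 < u) (huv : u ≤ v) :
    eulerFactor t u ≤ eulerFactor t v := by
  have hv : 0 < v := hu.trans_le huv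
  have h : u ^ 2 ≤ v ^ 2 := by gcongr
  rw [eulerFactor, eulerFactor, div_le_div_iff₀ (by positivity) (by positivity)]
  nlinarith [mul_le_mul_of_nonneg_right h (sq_nonneg t)]

/-- The factors are logarithmically concave in `u`. -/
lemma eulerFactor_rpow_mul_le (t : ℝ) {p q l : ℝ} (hp : 0 < p) (hq : 0 < q) (hl0 : 0 ≤ l)
    (hl1 : l ≤ 1) : eulerFactor t p ^ l * eulerFactor t q ^ (1 - l) ≤
      eulerFactor t (l * p + (1 - l) * q) := by
  have hl2 : 0 ≤ 1 - l := by linarith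
  set m : ℝ := l * p + (1 - l) * q with hm
  have hgm : p ^ l * q ^ (1 - l) ≤ m :=
    Real.geom_mean_le_arith_mean2_weighted hl0 hl2 hp.le hq.le (by ring)
  have hg0 : 0 < p ^ l * q ^ (1 - l) := by positivity
  have hm0 : 0 < m := hg0.trans_le hgm
  set X : ℝ := eulerFactor t p with hX
  set Y : ℝ := eulerFactor t q with hY
  have hX0 : 0 < X := by rw [hX, eulerFactor]; positivity
  have hY0 : 0 < Y := by rw [hY, eulerFactor]; positivity
  have hXc : 1 - X = X * (t ^ 2 / p ^ 2) := by rw [hX, eulerFactor]; field_simp; ring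
  have hYc : 1 - Y = Y * (t ^ 2 / q ^ 2) := by rw [hY, eulerFactor]; field_simp; ring
  have hX1 : 0 ≤ 1 - X := by rw [hXc]; positivity
  have hY1 : 0 ≤ 1 - Y := by rw [hYc]; positivity
  have h1 := Real.geom_mean_le_arith_mean2_weighted hl0 hl2 hX0.le hY0.le (by ring)
  have h2 := Real.geom_mean_le_arith_mean2_weighted hl0 hl2 hX1 hY1 (by ring)
  have hsq (x e : ℝ) (hx : 0 < x) : (x ^ 2) ^ e = (x ^ e) ^ 2 := by
    rw [← Real.rpow_natCast, ← Real.rpow_natCast, ← Real.rpow_mul hx.le, ← Real.rpow_mul hx.le,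
      mul_comm]
  have ht : (t ^ 2) ^ l * (t ^ 2) ^ (1 - l) = t ^ 2 := by
    rcases eq_or_ne t 0 with rfl | ht
    · rcases eq_or_ne l 0 with rfl | hl
      · simp
      · rw [zero_pow two_ne_zero, Real.zero_rpow hl, zero_mul]
    · rw [← Real.rpow_add (by positivity)]
      simp
  have hV : (1 - X) ^ l * (1 - Y) ^ (1 - l) =
      X ^ l * Y ^ (1 - l) * (t ^ 2 / (p ^ l * q ^ (1 - l)) ^ 2) := by
    rw [hXc, hYc, Real.mul_rpow hX0.le (by positivity), Real.mul_rpow hY0.le (by positivity),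
      Real.div_rpow (by positivity) (by positivity), Real.div_rpow (by positivity) (by positivity),
      hsq p l hp, hsq q (1 - l) hq, mul_pow]
    calc _ = X ^ l * Y ^ (1 - l) * (((t ^ 2) ^ l * (t ^ 2) ^ (1 - l)) /
          ((p ^ l) ^ 2 * (q ^ (1 - l)) ^ 2)) := by field_simp
      _ = _ := by rw [ht]
  have hT0 : 0 < X ^ l * Y ^ (1 - l) := by positivity
  have h3 : X ^ l * Y ^ (1 - l) * (1 + t ^ 2 / m ^ 2) ≤ 1 := by
    have h4 : t ^ 2 / m ^ 2 ≤ t ^ 2 / (p ^ l * q ^ (1 - l)) ^ 2 := by gcongr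
    have h5 := mul_le_mul_of_nonneg_left h4 hT0.le
    rw [← hV] at h5
    linarith
  rw [eulerFactor, le_div_iff₀ (by positivity)]
  have h6 : X ^ l * Y ^ (1 - l) * (m ^ 2 + t ^ 2) =
      m ^ 2 * (X ^ l * Y ^ (1 - l) * (1 + t ^ 2 / m ^ 2)) := by field_simp
  rw [h6]
  exact mul_le_of_le_one_right (sq_nonneg m) h3

lemma tendsto_prod_eulerFactor {a : ℝ} (ha : 0 < a) (t : ℝ) :
    Tendsto (fun n : ℕ ↦ ∏ j ∈ Finset.range (n + 1), eulerFactor t (a + j)) atTop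
      (𝓝 ((‖Complex.Gamma (a + t * Complex.I)‖ / Real.Gamma a) ^ 2)) := by
  have h1 := (Complex.GammaSeq_tendsto_Gamma (a + t * Complex.I)).norm
  have h2 := (Complex.GammaSeq_tendsto_Gamma a).norm
  have hG : ‖Complex.Gamma a‖ = Real.Gamma a := by
    rw [Complex.Gamma_ofReal, Complex.norm_real,
      Real.norm_of_nonneg (Real.Gamma_pos_of_pos ha).le]
  rw [hG] at h2
  have h3 := (h1.div h2 (Real.Gamma_pos_of_pos ha).ne').pow 2
  refine h3.congr' ?_
  filter_upwards [eventually_gt_atTop 0] with n hn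
  have hn' : (0 : ℝ) < n := by exact_mod_cast hn
  have hfac : (0 : ℝ) < n.factorial := by exact_mod_cast n.factorial_pos
  simp only [Complex.GammaSeq, Pi.div_apply, norm_div, norm_mul,
    Complex.norm_natCast_cpow_of_pos hn, norm_prod, Complex.norm_natCast]
  have hre : ((a : ℂ) + t * Complex.I).re = a := by simp
  have hden (j : ℕ) : ‖(a : ℂ) + j‖ = a + j := by
    have : (a : ℂ) + j = ((a + j : ℝ) : ℂ) := by push_cast; ring
    rw [this, Complex.norm_real, Real.norm_of_nonneg (by positivity)]
  have hnum (j : ℕ) : ‖(a : ℂ) + t * Complex.I + j‖ ^ 2 = (a + j) ^ 2 + t ^ 2 := by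
    rw [← Complex.normSq_eq_norm_sq, Complex.normSq_apply]
    simp
    ring
  have hterm (j : ℕ) : eulerFactor t (a + j) =
      (‖(a : ℂ) + j‖ / ‖(a : ℂ) + t * Complex.I + j‖) ^ 2 := by
    rw [eulerFactor, div_pow, hnum, hden]
  simp_rw [hterm]
  rw [Finset.prod_pow, Finset.prod_div_distrib, hre, Complex.ofReal_re]
  have hpa : ∏ j ∈ Finset.range (n + 1), ‖(a : ℂ) + j‖ ≠ 0 :=
    Finset.prod_ne_zero_iff.2 fun j _ ↦ by rw [hden]; positivity
  have hpt : ∏ j ∈ Finset.range (n + 1), ‖(a : ℂ) + t * Complex.I + j‖ ≠ 0 :=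
    Finset.prod_ne_zero_iff.2 fun j _ h0 ↦ by
      have := hnum j
      rw [h0] at this
      have : 0 < (a + j) ^ 2 + t ^ 2 := by positivity
      linarith
  have hpow : (n : ℝ) ^ a ≠ 0 := (by positivity : 0 < (n : ℝ) ^ a).ne'
  congr 1
  field_simp

lemma norm_Gamma_div_sq_mono {a b : ℝ} (ha : 0 < a) (hab : a ≤ b) (t : ℝ) :
    (‖Complex.Gamma (a + t * Complex.I)‖ / Real.Gamma a) ^ 2 ≤
      (‖Complex.Gamma (b + t * Complex.I)‖ / Real.Gamma b) ^ 2 := by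
  refine le_of_tendsto_of_tendsto' (tendsto_prod_eulerFactor ha t)
    (tendsto_prod_eulerFactor (ha.trans_le hab) t) fun n ↦ ?_
  exact Finset.prod_le_prod (fun j _ ↦ eulerFactor_nonneg _ _)
    fun j _ ↦ eulerFactor_le_eulerFactor t (by positivity) (by linarith)

lemma norm_Gamma_div_sq_rpow_mul_le {a b l : ℝ} (ha : 0 < a) (hb : 0 < b) (hl0 : 0 < l)
    (hl1 : l ≤ 1) (t : ℝ) :
    ((‖Complex.Gamma (a + t * Complex.I)‖ / Real.Gamma a) ^ 2) ^ l *
      ((‖Complex.Gamma (b + t * Complex.I)‖ / Real.Gamma b) ^ 2) ^ (1 - l) ≤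
      (‖Complex.Gamma ((l * a + (1 - l) * b : ℝ) + t * Complex.I)‖ /
        Real.Gamma (l * a + (1 - l) * b)) ^ 2 := by
  have hl2 : 0 ≤ 1 - l := by linarith
  have hm : 0 < l * a + (1 - l) * b := by positivity
  refine le_of_tendsto_of_tendsto' (((tendsto_prod_eulerFactor ha t).rpow_const (Or.inr hl0.le)).mul
    ((tendsto_prod_eulerFactor hb t).rpow_const (Or.inr hl2))) (tendsto_prod_eulerFactor hm t)
    fun n ↦ ?_
  rw [← Real.finsetProd_rpow _ _ fun j _ ↦ eulerFactor_nonneg _ _,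
    ← Real.finsetProd_rpow _ _ fun j _ ↦ eulerFactor_nonneg _ _, ← Finset.prod_mul_distrib]
  refine Finset.prod_le_prod (fun j _ ↦ mul_nonneg
    (Real.rpow_nonneg (eulerFactor_nonneg _ _) _) (Real.rpow_nonneg (eulerFactor_nonneg _ _) _))
    fun j _ ↦ ?_
  refine (eulerFactor_rpow_mul_le t (by positivity) (by positivity) hl0.le hl1).trans_eq ?_
  congr 1
  ring

open scoped ComplexConjugate in
lemma norm_Gamma_half_sq (t : ℝ) :
    ‖Complex.Gamma ((1 / 2 : ℝ) + t * Complex.I)‖ ^ 2 = π / Real.cosh (π * t) := by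
  have h := Complex.Gamma_mul_Gamma_one_sub ((1 / 2 : ℝ) + t * Complex.I)
  have h1 : 1 - (((1 / 2 : ℝ) : ℂ) + t * Complex.I) =
      conj (((1 / 2 : ℝ) : ℂ) + t * Complex.I) := by
    simp only [map_add, map_mul, Complex.conj_ofReal, Complex.conj_I]
    push_cast
    ring
  rw [h1, Complex.Gamma_conj, Complex.mul_conj, Complex.normSq_eq_norm_sq] at h
  have h2 : (π : ℂ) * (((1 / 2 : ℝ) : ℂ) + t * Complex.I) = π / 2 + (π * t : ℂ) * Complex.I := by
    push_cast
    ring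
  rw [h2, Complex.sin_add, Complex.sin_pi_div_two, Complex.cos_pi_div_two, one_mul, zero_mul,
    add_zero, Complex.cos_mul_I] at h
  have h3 : ((‖Complex.Gamma ((1 / 2 : ℝ) + t * Complex.I)‖ ^ 2 : ℝ) : ℂ) =
      ((π / Real.cosh (π * t) : ℝ) : ℂ) := by
    rw [h]
    push_cast
    rfl
  exact Complex.ofReal_injective h3

open scoped ComplexConjugate in
lemma norm_Gamma_one_sq {t : ℝ} (ht : t ≠ 0) :
    ‖Complex.Gamma ((1 : ℝ) + t * Complex.I)‖ ^ 2 = π * t / Real.sinh (π * t) := by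
  have htI : (t * Complex.I : ℂ) ≠ 0 := by simp [ht]
  have h := Complex.Gamma_mul_Gamma_one_sub (t * Complex.I)
  have h1 : 1 - (t * Complex.I : ℂ) = conj (((1 : ℝ) : ℂ) + t * Complex.I) := by
    simp only [map_add, map_mul, Complex.conj_ofReal, Complex.conj_I]
    push_cast
    ring
  have h0 : Complex.Gamma ((1 : ℝ) + t * Complex.I) =
      t * Complex.I * Complex.Gamma (t * Complex.I) := by
    rw [← Complex.Gamma_add_one _ htI, Complex.ofReal_one, add_comm]
  have h2 : Complex.Gamma ((1 : ℝ) + t * Complex.I) * Complex.Gamma (1 - t * Complex.I) =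
      t * Complex.I * (π / Complex.sin (π * (t * Complex.I))) := by
    rw [h0, mul_assoc, h]
  rw [h1, Complex.Gamma_conj, Complex.mul_conj, Complex.normSq_eq_norm_sq,
    show (π : ℂ) * (t * Complex.I) = (π * t : ℂ) * Complex.I by ring, Complex.sin_mul_I] at h2
  have h3 : ((‖Complex.Gamma ((1 : ℝ) + t * Complex.I)‖ ^ 2 : ℝ) : ℂ) =
      ((π * t / Real.sinh (π * t) : ℝ) : ℂ) := by
    rw [h2]
    push_cast
    have hs : Complex.sinh (π * t) ≠ 0 := by
      have : Real.sinh (π * t) ≠ 0 := Real.sinh_ne_zero.2 (mul_ne_zero Real.pi_ne_zero ht)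
      exact_mod_cast this
    field_simp
  exact Complex.ofReal_injective h3

lemma div_sinh_le {x : ℝ} (hx : 0 < x) : x / Real.sinh x ≤ 2 * (1 + x) * Real.exp (-x) := by
  have h1 := Real.add_one_le_exp x
  have h2 : Real.exp (-x) ≤ 1 := Real.exp_le_one_iff.2 (by linarith)
  have h3 : Real.exp x * Real.exp (-x) = 1 := by rw [← Real.exp_add]; simp
  have h4 := Real.exp_pos (-x)
  rw [div_le_iff₀ (Real.sinh_pos_iff.2 hx), Real.sinh_eq]
  have h5 : 2 * (1 + x) * Real.exp (-x) * ((Real.exp x - Real.exp (-x)) / 2) =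
      (1 + x) * (1 - Real.exp (-x) ^ 2) := by linear_combination (1 + x) * h3
  rw [h5]
  nlinarith [mul_le_mul_of_nonneg_right h1 h4.le]

lemma le_div_sinh {x : ℝ} (hx : 0 < x) : 1 / 2 * (1 + x) * Real.exp (-x) ≤ x / Real.sinh x := by
  have h3 : Real.exp x * Real.exp (-x) = 1 := by rw [← Real.exp_add]; simp
  have h4 := Real.exp_pos (-x)
  rw [le_div_iff₀ (Real.sinh_pos_iff.2 hx), Real.sinh_eq]
  have h5 : 1 / 2 * (1 + x) * Real.exp (-x) * ((Real.exp x - Real.exp (-x)) / 2) =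
      1 / 4 * (1 + x) * (1 - Real.exp (-x) ^ 2) := by
    linear_combination (1 / 4 * (1 + x)) * h3
  have h6 : 1 - 2 * x ≤ Real.exp (-x) ^ 2 := by
    rw [← Real.exp_nat_mul]
    have := Real.add_one_le_exp (((2 : ℕ) : ℝ) * -x)
    push_cast at this ⊢
    linarith
  rw [h5]
  rcases le_total (1 / 3) x with h | h
  · nlinarith [sq_nonneg (Real.exp (-x))]
  · nlinarith

lemma exp_abs_le_two_mul_cosh (x : ℝ) : Real.exp |x| ≤ 2 * Real.cosh x := by
  rw [← Real.cosh_abs, Real.cosh_eq]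
  linarith [Real.exp_pos (-|x|)]

lemma norm_Gamma_one_sq_bounds (t : ℝ) :
    1 / 2 * (1 + π * |t|) * Real.exp (-(π * |t|)) ≤
      ‖Complex.Gamma ((1 : ℝ) + t * Complex.I)‖ ^ 2 ∧
    ‖Complex.Gamma ((1 : ℝ) + t * Complex.I)‖ ^ 2 ≤
      2 * (1 + π * |t|) * Real.exp (-(π * |t|)) := by
  rcases eq_or_ne t 0 with rfl | ht
  · simp
    norm_num
  · have habs : 0 < π * |t| := by positivity
    have heq : π * t / Real.sinh (π * t) = π * |t| / Real.sinh (π * |t|) := by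
      rcases abs_cases t with h | h
      · rw [h.1]
      · rw [h.1, mul_neg, Real.sinh_neg, neg_div_neg_eq]
    rw [norm_Gamma_one_sq ht, heq]
    exact ⟨le_div_sinh habs, div_sinh_le habs⟩

/-- A crude bound with the right exponential decay and an explicit dependence on `a`. -/
lemma norm_Gamma_le_of_le_one {a : ℝ} (ha : 0 < a) (ha1 : a ≤ 1) (t : ℝ) :
    ‖Complex.Gamma (a + t * Complex.I)‖ ≤
      Real.Gamma a * (3 * (1 + |t|) * Real.exp (-(π / 2 * |t|))) := by
  have hG := Real.Gamma_pos_of_pos ha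
  have h := norm_Gamma_div_sq_mono ha ha1 t
  rw [Real.Gamma_one, div_one] at h
  have h2 := h.trans (norm_Gamma_one_sq_bounds t).2
  have hsq : Real.exp (-(π * |t|)) = Real.exp (-(π / 2 * |t|)) ^ 2 := by
    rw [← Real.exp_nat_mul]
    congr 1
    push_cast
    ring
  have h3 : (‖Complex.Gamma (a + t * Complex.I)‖ / Real.Gamma a) ^ 2 ≤
      (3 * (1 + |t|) * Real.exp (-(π / 2 * |t|))) ^ 2 := by
    refine h2.trans ?_
    rw [mul_pow, hsq]
    gcongr
    have := abs_nonneg t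
    nlinarith [Real.pi_lt_four]
  have h4 := le_of_sq_le_sq h3 (by positivity)
  rwa [div_le_iff₀ hG, mul_comm _ (Real.Gamma a)] at h4

/-- Stirling's bound on a vertical line to the left of `1/2`. By log-concavity of Euler's factors
it follows from the exact values of `|Γ|` on the lines `Re s = 1/2` and `Re s = 1`. -/
lemma exists_norm_Gamma_le {a : ℝ} (ha : 0 < a) (ha2 : a < 1 / 2) : ∃ C, 0 ≤ C ∧ ∀ t : ℝ,
    ‖Complex.Gamma (a + t * Complex.I)‖ ≤
      C * (1 + |t|) ^ (a - 1 / 2) * Real.exp (-(π / 2 * |t|)) := by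
  have hG := Real.Gamma_pos_of_pos ha
  -- `l` is chosen so that `l a + (1 - l) = 1/2`
  set l : ℝ := 1 / (2 * (1 - a)) with hl
  have h1a : 0 < 1 - a := by linarith
  have hl0 : 0 < l := by positivity
  have hl1 : l ≤ 1 := by rw [hl, div_le_one (by positivity)]; linarith
  have hmid : l * a + (1 - l) * 1 = 1 / 2 := by rw [hl]; field_simp; ring
  have hexp : (1 - l) * (1 / (2 * l)) = 1 / 2 - a := by rw [hl]; field_simp; ring
  refine ⟨Real.Gamma a * (4 : ℝ) ^ (1 / (2 * l)), by positivity, fun t ↦ ?_⟩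
  set x : ℝ := π * |t| with hx
  have hx0 : 0 ≤ x := by positivity
  set G : ℝ := ‖Complex.Gamma (a + t * Complex.I)‖ / Real.Gamma a with hGdef
  have hG0 : 0 ≤ G := by positivity
  have h := norm_Gamma_div_sq_rpow_mul_le ha one_pos hl0 hl1 t
  rw [hmid, Real.Gamma_one, div_one, ← hGdef,
    div_pow ‖Complex.Gamma ((1 / 2 : ℝ) + t * Complex.I)‖, norm_Gamma_half_sq, Real.Gamma_one_half_eq,
    Real.sq_sqrt Real.pi_pos.le] at h
  have hcosh : π / Real.cosh (π * t) / π ≤ 2 * Real.exp (-x) := by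
    have h1 := exp_abs_le_two_mul_cosh (π * t)
    rw [abs_mul, abs_of_pos Real.pi_pos, ← hx] at h1
    have h2 := Real.cosh_pos (π * t)
    rw [div_div, mul_comm _ π, div_mul_cancel_left₀ Real.pi_ne_zero, Real.exp_neg,
      inv_le_iff_one_le_mul₀ h2]
    field_simp
    linarith
  have hlow : (1 / 2 * (1 + x) * Real.exp (-x)) ^ (1 - l) ≤
      (‖Complex.Gamma ((1 : ℝ) + t * Complex.I)‖ ^ 2) ^ (1 - l) := by
    have := (norm_Gamma_one_sq_bounds t).1
    gcongr
  have hE := Real.exp_pos (-x)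
  have hmain : (G ^ 2) ^ l * ((1 + x) * Real.exp (-x)) ^ (1 - l) ≤ 4 * Real.exp (-x) := by
    have h1 : (G ^ 2) ^ l * (1 / 2 * (1 + x) * Real.exp (-x)) ^ (1 - l) ≤ 2 * Real.exp (-x) :=
      ((mul_le_mul_of_nonneg_left hlow (by positivity)).trans h).trans hcosh
    rw [mul_assoc, Real.mul_rpow (by norm_num) (by positivity)] at h1
    have h2 : (1 / 2 : ℝ) ≤ (1 / 2 : ℝ) ^ (1 - l) := by
      simpa using Real.rpow_le_rpow_of_exponent_ge (by norm_num : (0 : ℝ) < 1 / 2) (by norm_num)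
        (by linarith : 1 - l ≤ 1)
    have h3 : 0 ≤ (G ^ 2) ^ l * ((1 + x) * Real.exp (-x)) ^ (1 - l) := by positivity
    nlinarith [mul_le_mul_of_nonneg_right h2 h3]
  have hpow : (G ^ 2) ^ l ≤ 4 * ((1 + x) ^ (-(1 - l)) * Real.exp (-x) ^ l) := by
    have h1 : 0 < ((1 + x) * Real.exp (-x)) ^ (1 - l) := by positivity
    rw [← le_div_iff₀ h1] at hmain
    refine hmain.trans_eq ?_
    rw [Real.mul_rpow (by positivity) hE.le, Real.rpow_neg (by positivity)]
    have h2 : Real.exp (-x) = Real.exp (-x) ^ l * Real.exp (-x) ^ (1 - l) := by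
      rw [← Real.rpow_add hE]
      simp
    nth_rewrite 1 [h2]
    field_simp
  have hfin : G ≤ (4 : ℝ) ^ (1 / (2 * l)) * ((1 + x) ^ (a - 1 / 2) * Real.exp (-(π / 2 * |t|))) := by
    have h1 : G = ((G ^ 2) ^ l) ^ (1 / (2 * l)) := by
      rw [← Real.rpow_mul (by positivity), ← Real.rpow_natCast, ← Real.rpow_mul hG0,
        show ((2 : ℕ) : ℝ) * (l * (1 / (2 * l))) = 1 by push_cast; field_simp, Real.rpow_one]
    rw [h1]
    refine (Real.rpow_le_rpow (by positivity) hpow (by positivity)).trans_eq ?_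
    rw [Real.mul_rpow (by norm_num) (by positivity), Real.mul_rpow (by positivity) (by positivity),
      ← Real.rpow_mul (by positivity), ← Real.rpow_mul hE.le, neg_mul, hexp, ← Real.exp_mul]
    congr 3
    · ring
    · rw [hx]
      field_simp
  have hbase : (1 + x) ^ (a - 1 / 2) ≤ (1 + |t|) ^ (a - 1 / 2) := by
    refine Real.rpow_le_rpow_of_nonpos (by positivity) ?_ (by linarith)
    rw [hx]
    nlinarith [Real.pi_gt_three, abs_nonneg t]
  rw [hGdef, div_le_iff₀ hG] at hfin
  refine hfin.trans ?_
  calc _ ≤ (4 : ℝ) ^ (1 / (2 * l)) * ((1 + |t|) ^ (a - 1 / 2) * Real.exp (-(π / 2 * |t|))) *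
        Real.Gamma a := by gcongr
    _ = _ := by ring

/-! ### Shifting the line of integration -/

lemma integrable_one_add_abs_rpow {r : ℝ} (hr : r < -1) :
    MeasureTheory.Integrable fun t : ℝ ↦ (1 + |t|) ^ r := by
  have h : MeasureTheory.Integrable fun t : ℝ ↦ (1 + ‖t‖) ^ (-(-r)) :=
    integrable_one_add_norm (by simpa using by linarith)
  simpa using h

open MeasureTheory in
/-- Cauchy's theorem on a vertical strip, for a function decaying like `|t|⁻²`. -/
lemma integral_vertical_line_eq {f : ℂ → ℂ} {a b K : ℝ} (hab : a ≤ b)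
    (hf : DifferentiableOn ℂ f {w | a ≤ w.re ∧ w.re ≤ b})
    (ha : Integrable fun t : ℝ ↦ f (a + t * Complex.I))
    (hb : Integrable fun t : ℝ ↦ f (b + t * Complex.I))
    (hK : ∀ σ t : ℝ, a ≤ σ → σ ≤ b → ‖f (σ + t * Complex.I)‖ ≤ K * (1 + |t|) ^ (-2 : ℝ)) :
    ∫ t : ℝ, f (a + t * Complex.I) = ∫ t : ℝ, f (b + t * Complex.I) := by
  have hbot : Tendsto (fun T : ℝ ↦ -T) atTop atBot := tendsto_neg_atTop_atBot
  have hA := intervalIntegral_tendsto_integral ha hbot tendsto_id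
  have hB := intervalIntegral_tendsto_integral hb hbot tendsto_id
  have hdecay : Tendsto (fun T : ℝ ↦ K * (1 + |T|) ^ (-2 : ℝ) * |b - a|) atTop (𝓝 0) := by
    have h1 : Tendsto (fun T : ℝ ↦ 1 + |T|) atTop atTop :=
      tendsto_atTop_add_const_left _ _ tendsto_abs_atTop_atTop
    have h2 := ((tendsto_rpow_neg_atTop (by norm_num : (0 : ℝ) < 2)).comp h1)
    simpa using (h2.const_mul K).mul_const |b - a|
  have hhor (s : ℝ → ℝ) (hs : ∀ T, |s T| = |T|) : Tendsto
      (fun T : ℝ ↦ ∫ x in a..b, f (x + s T * Complex.I)) atTop (𝓝 0) := by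
    refine squeeze_zero_norm (fun T ↦ ?_) hdecay
    refine intervalIntegral.norm_integral_le_of_norm_le_const fun x hx ↦ ?_
    rw [Set.uIoc_of_le hab] at hx
    simpa [hs T] using hK x (s T) hx.1.le hx.2
  have hrect (T : ℝ) : (∫ x in a..b, f (x + (-T : ℝ) * Complex.I)) -
      (∫ x in a..b, f (x + T * Complex.I)) +
      Complex.I • (∫ y in (-T)..T, f (b + y * Complex.I)) -
      Complex.I • (∫ y in (-T)..T, f (a + y * Complex.I)) = 0 := by
    have h := Complex.integral_boundary_rect_eq_zero_of_differentiableOn f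
      (a + (-T : ℝ) * Complex.I) (b + T * Complex.I) (hf.mono fun w hw ↦ ?_)
    · simpa using h
    · have := (Complex.mem_reProdIm.1 hw).1
      simp only [Complex.add_re, Complex.ofReal_re, Complex.mul_re, Complex.I_re, mul_zero,
        Complex.ofReal_im, Complex.I_im, zero_mul, sub_zero, add_zero, Set.uIcc_of_le hab] at this
      exact this
  have hlim := (((hhor (fun T ↦ -T) fun T ↦ abs_neg T).sub (hhor (fun T ↦ T) fun _ ↦ rfl)).add
    (hB.const_smul Complex.I)).sub (hA.const_smul Complex.I)
  have hz := tendsto_nhds_unique (hlim.congr hrect) tendsto_const_nhds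
  rw [sub_zero, zero_add, ← smul_sub, smul_eq_zero] at hz
  rcases hz with h | h
  · exact absurd h Complex.I_ne_zero
  · exact (sub_eq_zero.1 h).symm

/-- `Γ(1 - w) z^w / w`, the Mellin transform of `1 - e^{-zu}` at `-w`. -/
noncomputable def expMellin (z w : ℂ) : ℂ := Complex.Gamma (1 - w) / w * z ^ w

lemma one_sub_re_add_mul_I (σ t : ℝ) :
    1 - ((σ : ℂ) + t * Complex.I) = ((1 - σ : ℝ) : ℂ) + ((-t : ℝ) : ℂ) * Complex.I := by
  push_cast
  ring

lemma norm_cpow_add_mul_I_le {z : ℂ} (hz0 : z ≠ 0) (σ t : ℝ) :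
    ‖z ^ ((σ : ℂ) + t * Complex.I)‖ ≤ ‖z‖ ^ σ * Real.exp (|z.arg| * |t|) := by
  rw [Complex.norm_cpow_of_ne_zero hz0, div_eq_mul_inv, ← Real.exp_neg]
  simp only [Complex.add_re, Complex.ofReal_re, Complex.mul_re, Complex.I_re, mul_zero,
    Complex.ofReal_im, Complex.I_im, sub_zero, add_zero, Complex.add_im, Complex.mul_im,
    mul_one, zero_add]
  gcongr
  rw [← abs_mul]
  exact neg_le_abs _

/-- On compact parts of the strip the transform decays faster than any power of `t`, but only for
`z` in the open half-plane, and not uniformly. -/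
lemma exists_norm_expMellin_le {z : ℂ} (hz : 0 < z.re) {a b : ℝ} (ha : 0 < a) (hb : b < 1) :
    ∃ K, 0 ≤ K ∧ ∀ σ t : ℝ, a ≤ σ → σ ≤ b →
      ‖expMellin z (σ + t * Complex.I)‖ ≤ K * (1 + |t|) ^ (-3 : ℝ) := by
  have hz0 : z ≠ 0 := fun h ↦ by simp [h] at hz
  set κ : ℝ := π / 2 - |z.arg| with hκ
  have hκ0 : 0 < κ := by
    have := Complex.abs_arg_lt_pi_div_two_iff.2 (Or.inl hz)
    linarith
  obtain ⟨G, hG⟩ : ∃ G, ∀ x ∈ Set.Icc (1 - b) (1 - a), ‖Real.Gamma x‖ ≤ G := by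
    refine isCompact_Icc.exists_bound_of_continuousOn fun x hx ↦ ?_
    refine (Real.differentiableAt_Gamma fun m h ↦ ?_).continuousAt.continuousWithinAt
    have h1 : (0 : ℝ) ≤ m := m.cast_nonneg
    linarith [hx.1]
  obtain ⟨Z, hZ⟩ : ∃ Z, ∀ σ ∈ Set.Icc a b, ‖‖z‖ ^ σ‖ ≤ Z := by
    refine isCompact_Icc.exists_bound_of_continuousOn (Continuous.continuousOn ?_)
    exact Real.continuous_const_rpow (norm_ne_zero_iff.2 hz0)
  refine ⟨|G| * 3 / a * |Z| * (Real.exp κ * (24 / κ ^ 4)), by positivity,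
    fun σ t h1 h2 ↦ ?_⟩
  have hσ : 0 < σ := ha.trans_le h1
  have hw : a ≤ ‖(σ : ℂ) + t * Complex.I‖ := by
    have := Complex.re_le_norm ((σ : ℂ) + t * Complex.I)
    simp at this
    linarith
  have hΓ : ‖Complex.Gamma (1 - ((σ : ℂ) + t * Complex.I))‖ ≤
      |G| * (3 * (1 + |t|) * Real.exp (-(π / 2 * |t|))) := by
    rw [one_sub_re_add_mul_I]
    refine (norm_Gamma_le_of_le_one (by linarith) (by linarith) _).trans ?_
    rw [abs_neg]
    gcongr
    exact (Real.le_norm_self _).trans ((hG (1 - σ) ⟨by linarith, by linarith⟩).trans (le_abs_self G))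
  have hpow : ‖z ^ ((σ : ℂ) + t * Complex.I)‖ ≤ |Z| * Real.exp (|z.arg| * |t|) := by
    refine (norm_cpow_add_mul_I_le hz0 σ t).trans ?_
    gcongr
    exact (Real.le_norm_self _).trans ((hZ σ ⟨h1, h2⟩).trans (le_abs_self Z))
  have hfac : (κ * (1 + |t|)) ^ 4 / 24 ≤ Real.exp (κ * (1 + |t|)) := by
    have := Real.pow_div_factorial_le_exp (κ * (1 + |t|)) (by positivity) 4
    norm_num [Nat.factorial] at this
    exact this
  have h1t : 0 < 1 + |t| := by positivity
  have hdecay : (1 + |t|) * Real.exp (-(κ * |t|)) ≤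
      Real.exp κ * (24 / κ ^ 4) * (1 + |t|) ^ (-3 : ℝ) := by
    have h3 : (1 + |t|) ^ (-3 : ℝ) = ((1 + |t|) ^ 3)⁻¹ := by
      rw [Real.rpow_neg h1t.le]
      norm_cast
    have h4 : Real.exp (-(κ * |t|)) * Real.exp (κ * (1 + |t|)) = Real.exp κ := by
      rw [← Real.exp_add]
      congr 1
      ring
    rw [h3, ← h4]
    have h5 : (1 + |t|) * Real.exp (-(κ * |t|)) = Real.exp (-(κ * |t|)) *
        ((κ * (1 + |t|)) ^ 4 / 24) * (24 / κ ^ 4) * ((1 + |t|) ^ 3)⁻¹ := by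
      field_simp
    rw [h5]
    gcongr
  rw [expMellin, norm_mul, norm_div]
  calc _ ≤ |G| * (3 * (1 + |t|) * Real.exp (-(π / 2 * |t|))) / a *
        (|Z| * Real.exp (|z.arg| * |t|)) := by gcongr
    _ = |G| * 3 / a * |Z| * ((1 + |t|) * Real.exp (-(κ * |t|))) := by
      have : Real.exp (-(κ * |t|)) = Real.exp (-(π / 2 * |t|)) * Real.exp (|z.arg| * |t|) := by
        rw [← Real.exp_add, hκ]
        congr 1
        ring
      rw [this]
      ring
    _ ≤ |G| * 3 / a * |Z| * (Real.exp κ * (24 / κ ^ 4) * (1 + |t|) ^ (-3 : ℝ)) := by gcongr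
    _ = _ := by ring

lemma differentiableOn_expMellin {z : ℂ} (hz0 : z ≠ 0) :
    DifferentiableOn ℂ (expMellin z) {w | 0 < w.re ∧ w.re < 1} := by
  rintro w ⟨h0, h1⟩
  have hw : w ≠ 0 := fun h ↦ by simp [h] at h0
  have hG : DifferentiableAt ℂ (fun w ↦ Complex.Gamma (1 - w)) w := by
    refine DifferentiableAt.comp w (Complex.differentiableAt_Gamma _ fun m h ↦ ?_) (by fun_prop)
    have : (1 - w).re = -(m : ℝ) := by rw [h]; simp
    have hm : (0 : ℝ) ≤ m := m.cast_nonneg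
    simp at this
    linarith
  have hc : DifferentiableAt ℂ (fun w ↦ z ^ w) w := differentiableAt_id.const_cpow (Or.inl hz0)
  exact ((hG.div differentiableAt_id hw).mul hc).differentiableWithinAt

lemma continuous_vertical_line {f : ℂ → ℂ} {U : Set ℂ} (hf : ContinuousOn f U) {σ : ℝ}
    (hU : ∀ t : ℝ, (σ : ℂ) + t * Complex.I ∈ U) : Continuous fun t : ℝ ↦ f (σ + t * Complex.I) :=
  hf.comp_continuous (by fun_prop) hU

lemma integrable_expMellin {z : ℂ} (hz : 0 < z.re) {σ : ℝ} (h0 : 0 < σ) (h1 : σ < 1) :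
    MeasureTheory.Integrable fun t : ℝ ↦ expMellin z (σ + t * Complex.I) := by
  have hz0 : z ≠ 0 := fun h ↦ by simp [h] at hz
  obtain ⟨K, -, hK⟩ := exists_norm_expMellin_le hz h0 h1
  refine ((integrable_one_add_abs_rpow (by norm_num : (-3 : ℝ) < -1)).const_mul K).mono'
    (continuous_vertical_line (differentiableOn_expMellin hz0).continuousOn
      fun t ↦ ?_).aestronglyMeasurable (.of_forall fun t ↦ hK σ t le_rfl le_rfl)
  constructor <;> simpa

/-- Mellin inversion for `1 - e^{-zu}`. -/
lemma oneSubExp_eq_integral {z : ℂ} (hz : 0 < z.re) {σ x : ℝ} (h0 : 0 < σ) (h1 : σ < 1)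
    (hx : 0 < x) : oneSubExp z x = (1 / (2 * π) : ℂ) *
      ∫ t : ℝ, (x : ℂ) ^ ((σ : ℂ) + t * Complex.I) * expMellin z (σ + t * Complex.I) := by
  have hz0 : z ≠ 0 := fun h ↦ by simp [h] at hz
  have hneg (t : ℝ) : ((-σ : ℝ) : ℂ) + t * Complex.I = -((σ : ℂ) + ((-t : ℝ) : ℂ) * Complex.I) := by
    push_cast
    ring
  have hmel (t : ℝ) : mellin (oneSubExp z) (((-σ : ℝ) : ℂ) + t * Complex.I) =
      expMellin z (σ + ((-t : ℝ) : ℂ) * Complex.I) := by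
    rw [hneg, mellin_oneSubExp hz.le hz0 (by simpa using h0) (by simpa using h1), expMellin]
  have hconv : MellinConvergent (oneSubExp z) ((-σ : ℝ) : ℂ) := by
    rw [Complex.ofReal_neg]
    exact mellinConvergent_oneSubExp hz.le (by simpa using h0) (by simpa using h1)
  have hvert : Complex.VerticalIntegrable (mellin (oneSubExp z)) (-σ) MeasureTheory.volume := by
    unfold Complex.VerticalIntegrable
    simp_rw [hmel]
    exact (integrable_expMellin hz h0 h1).comp_neg
  have hcont : ContinuousAt (oneSubExp z) x := by
    unfold oneSubExp
    fun_prop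
  rw [← mellinInv_mellin_eq (-σ) (oneSubExp z) hx hconv hvert hcont, mellinInv, Complex.real_smul]
  push_cast
  congr 1
  rw [← MeasureTheory.integral_neg_eq_self]
  refine MeasureTheory.integral_congr_ae (.of_forall fun t ↦ ?_)
  have h := hmel (-t)
  have h2 := hneg (-t)
  rw [neg_neg] at h h2
  push_cast at h h2
  simp only [smul_eq_mul, Complex.ofReal_neg]
  rw [h, h2, neg_neg]

open MeasureTheory in
/-- Summing the inversion formula over `n` on the line `Re w = 1/4` of absolute convergence. -/
lemma moebiusExpSum_eq_integral {z : ℂ} (hz : 0 < z.re) : moebiusExpSum z = (1 / (2 * π) : ℂ) *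
    ∫ t : ℝ, invZeta (3 / 2 - ((1 / 4 : ℝ) + t * Complex.I)) *
      expMellin z ((1 / 4 : ℝ) + t * Complex.I) := by
  have hint := integrable_expMellin hz (by norm_num : (0 : ℝ) < 1 / 4) (by norm_num)
  set F : ℕ → ℝ → ℂ := fun n t ↦ (moebiusCoeff n : ℂ) * (n : ℂ) ^ (((1 / 4 : ℝ) : ℂ) + t * Complex.I) *
    expMellin z ((1 / 4 : ℝ) + t * Complex.I) with hF
  have hbound (n : ℕ) (t : ℝ) : ‖F n t‖ ≤
      (n : ℝ) ^ (-(5 / 4) : ℝ) * ‖expMellin z ((1 / 4 : ℝ) + t * Complex.I)‖ := by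
    rw [hF]
    simp only [norm_mul _ (expMellin z _)]
    gcongr
    refine (norm_moebiusCoeff_mul_cpow_le n _).trans_eq ?_
    congr 1
    simp
    norm_num
  have hFint (n : ℕ) : Integrable (F n) := by
    refine (hint.norm.const_mul ((n : ℝ) ^ (-(5 / 4) : ℝ))).mono' ?_ (.of_forall (hbound n))
    rcases Nat.eq_zero_or_pos n with rfl | hn
    · have : F 0 = fun _ ↦ 0 := by
        funext t
        simp [hF, moebiusCoeff]
      rw [this]
      exact aestronglyMeasurable_const
    · refine AEStronglyMeasurable.mul (Continuous.aestronglyMeasurable ?_) hint.1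
      have hn' : (n : ℂ) ≠ 0 := by exact_mod_cast hn.ne'
      exact continuous_const.mul ((by fun_prop : Continuous fun t : ℝ ↦
        (((1 / 4 : ℝ) : ℂ) + t * Complex.I)).const_cpow (Or.inl hn'))
  have hs : Summable fun n ↦ ∫ t, ‖F n t‖ := by
    refine Summable.of_nonneg_of_le (fun n ↦ integral_nonneg fun t ↦ norm_nonneg _) (fun n ↦ ?_)
      ((Real.summable_nat_rpow.2 (by norm_num : (-(5 / 4) : ℝ) < -1)).mul_right
        (∫ t : ℝ, ‖expMellin z ((1 / 4 : ℝ) + t * Complex.I)‖))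
    rw [← integral_const_mul]
    exact integral_mono (hFint n).norm (hint.norm.const_mul _) (hbound n)
  have hsum := hasSum_integral_of_summable_integral_norm hFint hs
  have hval (t : ℝ) : ∑' n, F n t = invZeta (3 / 2 - ((1 / 4 : ℝ) + t * Complex.I)) *
      expMellin z ((1 / 4 : ℝ) + t * Complex.I) := by
    rw [hF]
    simp only
    rw [tsum_mul_right, (hasSum_moebiusCoeff_mul_cpow (by simp; norm_num)).tsum_eq]
  simp_rw [hval] at hsum
  rw [← (hsum.mul_left (1 / (2 * π) : ℂ)).tsum_eq, moebiusExpSum]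
  refine tsum_congr fun n ↦ ?_
  rcases Nat.eq_zero_or_pos n with rfl | hn
  · simp [hF, moebiusCoeff]
  · have h := oneSubExp_eq_integral hz (by norm_num : (0 : ℝ) < 1 / 4) (by norm_num)
      (by exact_mod_cast hn : (0 : ℝ) < n)
    rw [oneSubExp, Complex.ofReal_natCast] at h
    rw [h, ← mul_assoc, mul_comm (moebiusCoeff n : ℂ), mul_assoc, ← integral_const_mul]
    simp only [hF, mul_assoc]

/-! ### The bound under the Riemann Hypothesis -/

lemma three_half_sub_re (σ t : ℝ) : (3 / 2 - ((σ : ℂ) + t * Complex.I)).re = 3 / 2 - σ := by simp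

lemma abs_three_half_sub_im (σ t : ℝ) : |(3 / 2 - ((σ : ℂ) + t * Complex.I)).im| = |t| := by simp

lemma differentiableOn_invZeta_mul_expMellin (h : RiemannHypothesis) {z : ℂ} (hz0 : z ≠ 0) :
    DifferentiableOn ℂ (fun w ↦ invZeta (3 / 2 - w) * expMellin z w)
      {w | 0 < w.re ∧ w.re < 1} := by
  refine DifferentiableOn.mul (fun w hw ↦ ?_) (differentiableOn_expMellin hz0)
  have hne : riemannZeta₁ (3 / 2 - w) ≠ 0 := by
    refine h.riemannZeta₁_ne_zero ?_
    have : (3 / 2 - w).re = 3 / 2 - w.re := by simp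
    rw [this]
    linarith [hw.2]
  unfold invZeta
  have hd := differentiable_riemannZeta₁ (3 / 2 - w)
  exact (DifferentiableAt.div (by fun_prop) (hd.comp w (by fun_prop)) hne).differentiableWithinAt

open MeasureTheory in
/-- On the line `Re w = 1 - ε` the integrand is bounded uniformly in `z`, up to the factor
`‖z‖^{1-ε}`. -/
lemma RiemannHypothesis.exists_norm_moebiusExpSum_le_of_re_pos (h : RiemannHypothesis) {ε : ℝ}
    (hε : 0 < ε) (hε1 : ε ≤ 1 / 8) :
    ∃ C, ∀ z : ℂ, 0 < z.re → ‖moebiusExpSum z‖ ≤ C * ‖z‖ ^ (1 - ε) := by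
  obtain ⟨Z, hZ0, hZ⟩ := h.norm_invZeta_le hε (by linarith) (by norm_num : (0 : ℝ) < 1 / 8)
  obtain ⟨G, hG0, hG⟩ := exists_norm_Gamma_le hε (by linarith)
  have hInt := (integrable_one_add_abs_rpow (by norm_num : (-(5 / 4) : ℝ) < -1)).const_mul
    (Z * (G * 3))
  refine ⟨1 / (2 * π) * ∫ t : ℝ, Z * (G * 3) * (1 + |t|) ^ (-(5 / 4) : ℝ), fun z hz ↦ ?_⟩
  have hz0 : z ≠ 0 := fun h ↦ by simp [h] at hz
  have hdiff := differentiableOn_invZeta_mul_expMellin h hz0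
  obtain ⟨K, hK0, hK⟩ := exists_norm_expMellin_le hz (by norm_num : (0 : ℝ) < 1 / 4)
    (by linarith : 1 - ε < 1)
  have hstrip (σ t : ℝ) (h1 : 1 / 4 ≤ σ) (h2 : σ ≤ 1 - ε) :
      ‖invZeta (3 / 2 - ((σ : ℂ) + t * Complex.I)) * expMellin z (σ + t * Complex.I)‖ ≤
        Z * K * (1 + |t|) ^ (-2 : ℝ) := by
    have h3 := hZ (3 / 2 - ((σ : ℂ) + t * Complex.I)) (by rw [three_half_sub_re]; linarith)
      (by rw [three_half_sub_re]; linarith)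
    rw [abs_three_half_sub_im] at h3
    have h1t : 1 ≤ 1 + |t| := by linarith [abs_nonneg t]
    have h4 : (1 + |t|) ^ (1 / 8 : ℝ) * (1 + |t|) ^ (-3 : ℝ) ≤ (1 + |t|) ^ (-2 : ℝ) := by
      rw [← Real.rpow_add (by linarith)]
      exact Real.rpow_le_rpow_of_exponent_le h1t (by norm_num)
    rw [norm_mul]
    calc _ ≤ Z * (1 + |t|) ^ (1 / 8 : ℝ) * (K * (1 + |t|) ^ (-3 : ℝ)) :=
          mul_le_mul h3 (hK σ t h1 h2) (norm_nonneg _) (by positivity)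
      _ = Z * K * ((1 + |t|) ^ (1 / 8 : ℝ) * (1 + |t|) ^ (-3 : ℝ)) := by ring
      _ ≤ _ := by gcongr
  have hintegrable (σ : ℝ) (h1 : 1 / 4 ≤ σ) (h2 : σ ≤ 1 - ε) : Integrable fun t : ℝ ↦
      invZeta (3 / 2 - ((σ : ℂ) + t * Complex.I)) * expMellin z (σ + t * Complex.I) := by
    refine ((integrable_one_add_abs_rpow (by norm_num : (-2 : ℝ) < -1)).const_mul (Z * K)).mono'
      (continuous_vertical_line hdiff.continuousOn fun t ↦ ?_).aestronglyMeasurable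
      (.of_forall fun t ↦ hstrip σ t h1 h2)
    constructor <;> simp <;> linarith
  have hshift := integral_vertical_line_eq
    (f := fun w ↦ invZeta (3 / 2 - w) * expMellin z w) (a := 1 / 4) (b := 1 - ε) (by linarith)
    (hdiff.mono fun w hw ↦ ⟨by linarith [hw.1], by linarith [hw.2]⟩)
    (hintegrable _ le_rfl (by linarith)) (hintegrable _ (by linarith) le_rfl) hstrip
  rw [moebiusExpSum_eq_integral hz, hshift, norm_mul]
  have hline (t : ℝ) : ‖invZeta (3 / 2 - (((1 - ε : ℝ) : ℂ) + t * Complex.I)) *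
      expMellin z ((1 - ε : ℝ) + t * Complex.I)‖ ≤
        Z * (G * 3) * (1 + |t|) ^ (-(5 / 4) : ℝ) * ‖z‖ ^ (1 - ε) := by
    have h1t : 1 ≤ 1 + |t| := by linarith [abs_nonneg t]
    have h1t0 : 0 < 1 + |t| := by linarith
    have h3 := hZ (3 / 2 - (((1 - ε : ℝ) : ℂ) + t * Complex.I))
      (by rw [three_half_sub_re]; linarith) (by rw [three_half_sub_re]; linarith)
    rw [abs_three_half_sub_im] at h3
    have h4 : ‖Complex.Gamma (1 - (((1 - ε : ℝ) : ℂ) + t * Complex.I))‖ ≤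
        G * (1 + |t|) ^ (ε - 1 / 2) * Real.exp (-(π / 2 * |t|)) := by
      have := hG (-t)
      rwa [abs_neg, ← sub_sub_cancel (1 : ℝ) ε, ← one_sub_re_add_mul_I, sub_sub_cancel] at this
    have h5 : (1 + |t|) / 3 ≤ ‖((1 - ε : ℝ) : ℂ) + t * Complex.I‖ := by
      have h6 := Complex.re_le_norm (((1 - ε : ℝ) : ℂ) + t * Complex.I)
      have h7 := Complex.abs_im_le_norm (((1 - ε : ℝ) : ℂ) + t * Complex.I)
      simp only [Complex.add_re, Complex.ofReal_re, Complex.mul_re, Complex.I_re, mul_zero,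
        Complex.ofReal_im, Complex.I_im, sub_zero, add_zero, Complex.add_im,
        Complex.mul_im, mul_one, zero_add] at h6 h7
      linarith
    have h8 : ‖z ^ (((1 - ε : ℝ) : ℂ) + t * Complex.I)‖ ≤
        ‖z‖ ^ (1 - ε) * Real.exp (π / 2 * |t|) := by
      refine (norm_cpow_add_mul_I_le hz0 _ t).trans ?_
      gcongr
      exact Complex.abs_arg_le_pi_div_two_iff.2 hz.le
    have h9 : Real.exp (-(π / 2 * |t|)) * Real.exp (π / 2 * |t|) = 1 := by
      rw [← Real.exp_add, neg_add_cancel, Real.exp_zero]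
    have h10 : (1 + |t|) ^ (1 / 8 : ℝ) * ((1 + |t|) ^ (ε - 1 / 2) * (1 + |t|)⁻¹) ≤
        (1 + |t|) ^ (-(5 / 4) : ℝ) := by
      rw [← Real.rpow_neg_one, ← Real.rpow_add h1t0, ← Real.rpow_add h1t0]
      exact Real.rpow_le_rpow_of_exponent_le h1t (by linarith)
    rw [expMellin, norm_mul, norm_mul, norm_div]
    calc _ ≤ Z * (1 + |t|) ^ (1 / 8 : ℝ) *
          (G * (1 + |t|) ^ (ε - 1 / 2) * Real.exp (-(π / 2 * |t|)) / ((1 + |t|) / 3) *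
            (‖z‖ ^ (1 - ε) * Real.exp (π / 2 * |t|))) := by gcongr
      _ = Z * (G * 3) * ((1 + |t|) ^ (1 / 8 : ℝ) * ((1 + |t|) ^ (ε - 1 / 2) * (1 + |t|)⁻¹)) *
            ‖z‖ ^ (1 - ε) * (Real.exp (-(π / 2 * |t|)) * Real.exp (π / 2 * |t|)) := by
          field_simp
      _ ≤ Z * (G * 3) * (1 + |t|) ^ (-(5 / 4) : ℝ) * ‖z‖ ^ (1 - ε) * 1 := by
          rw [h9]
          gcongr
      _ = _ := mul_one _
  have hn := norm_integral_le_of_norm_le (hInt.mul_const (‖z‖ ^ (1 - ε))) (.of_forall hline)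
  rw [integral_mul_const] at hn
  have h2π : ‖(1 / (2 * π) : ℂ)‖ = 1 / (2 * π) := by
    simp [abs_of_pos Real.pi_pos]
  rw [h2π, mul_assoc]
  gcongr

lemma continuousOn_moebiusExpSum : ContinuousOn moebiusExpSum {z | 0 ≤ z.re} := by
  refine continuousOn_tsum (u := fun n : ℕ ↦ (n : ℝ) ^ (-(3 / 2) : ℝ) * 2)
    (fun n ↦ by fun_prop) summable_rpow_neg_three_half_mul_two fun n z hz ↦ ?_
  rw [norm_mul, Complex.norm_real]
  gcongr
  · exact abs_moebiusCoeff_le n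
  · refine norm_one_sub_exp_neg_le_two ?_
    have hz : 0 ≤ z.re := hz
    simpa using by positivity

/-- The bound passes to the imaginary axis by continuity. -/
lemma RiemannHypothesis.exists_norm_moebiusExpSum_le (h : RiemannHypothesis) {ε : ℝ}
    (hε : 0 < ε) (hε1 : ε ≤ 1 / 8) :
    ∃ C, ∀ z : ℂ, 0 ≤ z.re → ‖moebiusExpSum z‖ ≤ C * ‖z‖ ^ (1 - ε) := by
  obtain ⟨C, hC⟩ := h.exists_norm_moebiusExpSum_le_of_re_pos hε hε1
  refine ⟨C, fun z hz ↦ ?_⟩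
  have ht : Tendsto (fun x : ℝ ↦ z + x) (𝓝[>] 0) (𝓝[{z | 0 ≤ z.re}] z) := by
    refine tendsto_nhdsWithin_iff.2 ⟨?_, ?_⟩
    · have : ContinuousAt (fun x : ℝ ↦ z + x) 0 := by fun_prop
      simpa using this.tendsto.mono_left (nhdsWithin_le_nhds (s := Set.Ioi 0))
    · filter_upwards [self_mem_nhdsWithin] with x hx
      have hx : 0 < x := hx
      simpa using add_nonneg hz hx.le
  have hcont : Continuous fun z : ℂ ↦ C * ‖z‖ ^ (1 - ε) :=
    continuous_const.mul (continuous_norm.rpow_const fun _ ↦ Or.inr (by linarith))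
  refine le_of_tendsto_of_tendsto (((continuousOn_moebiusExpSum z hz).tendsto.comp ht).norm)
    ((hcont.tendsto z).comp (ht.mono_right nhdsWithin_le_nhds)) ?_
  filter_upwards [self_mem_nhdsWithin] with x hx
  have hx : 0 < x := hx
  exact hC _ (by simpa using add_pos_of_nonneg_of_pos hz hx)

theorem RiemannHypothesis.criterionBound (h : RiemannHypothesis) {δ : ℝ} (hδ : δ < 0) :
    CriterionBound δ := by
  have hε : 0 < min (-δ) (1 / 8) := lt_min (by linarith) (by norm_num)
  obtain ⟨C, hC⟩ := h.exists_norm_moebiusExpSum_le hε (min_le_right _ _)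
  refine criterionBound_of_moebiusExpSum (θ := 1 - min (-δ) (1 / 8)) ?_
    fun z hz _ ↦ hC z hz.ge
  have := min_le_left (-δ) (1 / 8)
  linarith

theorem theorem2p1 :
    (∀ x : ℝ, 0 < x → Summable (criterionTerm x)) ∧
    (RiemannHypothesis ↔ ∀ δ' : ℝ, δ' < 0 → CriterionBound δ') ∧
    (∀ δ' : ℝ, δ' < -(1 / 2) → CriterionBound δ') ∧
    (RiemannHypothesis → ∀ δ' : ℝ, -(1 / 2) ≤ δ' → δ' < 0 → CriterionBound δ') := by
  refine ⟨fun x _ ↦ (hasSum_criterionTerm x).summable,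
    ⟨fun h δ' hδ ↦ h.criterionBound hδ, riemannHypothesis_of_criterionBound⟩,
    fun δ' hδ ↦ criterionBound_of_lt_neg_half hδ, fun h δ' _ hδ ↦ h.criterionBound hδ⟩
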